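/- **Notation.** Let $n\ge 2$. For $a,b>-1$ let $P_i^{(a,b)}$ be the Jacobi polynomial of degree $i$ normalized by $P_i^{(a,b)}(1)=1$, and let $P_i^{(n)}=P_i^{((n-3)/2,(n-3)/2)}$ be the Gegenbauer polynomials, which are orthogonal on $[-1,1]$ with respect to the probability measure $d\mu_n(t)=\gamma_n(1-t^2)^{(n-3)/2}dt$, $\gamma_n=\Gamma(\frac n2)/(\sqrt\pi\,\Gamma(\frac{n-1}2))$. For a polynomial $f=\sum_i f_iP_i^{(n)}$ we have $f_0=\int_{-1}^1 f\,d\mu_n$. For an integer $m\ge 1$ write $m=2k-1+\varepsilon$ with $k\ge 1$ and $\varepsilon\in\{0,1\}$, and put $$D(n,m)=\binom{n+k-2+\varepsilon}{n-1}+\binom{n+k-2}{n-1},$$ $$L_m(n,s)=\binom{k+n-3+\varepsilon}{n-2}\left[\frac{2k+n-3+2\varepsilon}{n-1}-\frac{(1+s)^{\varepsilon}\left(P^{(n)}_{k-1+\varepsilon}(s)-P^{(n)}_{k+\varepsilon}(s)\right)}{(1-s)\left(\varepsilon P^{(n)}_k(s)+P^{(n)}_{k+\varepsilon}(s)\right)}\right].$$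 The Levenshtein polynomial is, up to a positive factor, $$f_m^{(n,s)}(t)=(t-s)(t+1)^{\varepsilon}\Big(\sum_{i=0}^{k-1} r_i\,p_i(t)\,p_i(s)\Big)^2,$$ where $p_i=P_i^{(1+(n-3)/2,\ \varepsilon+(n-3)/2)}$ and $1/r_i=\int_{-1}^1 p_i(t)^2(1-t)(1+t)^{\varepsilon}\,d\mu_n(t)$. A weighted spherical code $(C,W)$ on $\mathbb S^{n-1}$ consists of distinct points $x_1,\dots,x_N\in\mathbb S^{n-1}$ and weights $w_i>0$ with $\sum_i w_i=1$. Its maximal inner product is $s(C)=\max_{i\ne j}x_i\cdot x_j$ (so $N\ge 2$), and $N_W=1/\sum_i w_i^2$. It is a weighted spherical $\tau$-design if $\sum_{i,j}w_iw_jP_\ell^{(n)}(x_i\cdot x_j)=0$ for $1\le \ell\le\tau$. For a function $h$ on $[-1,1)$ its weighted $h$-energy is $E_h(C,W)=\sum_{i\neq j}w_iw_jh(x_i\cdot x_j)$. **Theorem.** Let $\tau=2k-1+\varepsilon$ with $k\ge 1$, $\varepsilon\in\{0,1\}$. Let $h$ be real-valued and continuous on $[-1,1)$ and $\tau$ times differentiable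 on $(-1,1)$ with $h^{(\tau)}\ge 0$ on $(-1,1)$. Let $(C,W)$ be a weighted spherical $\tau$-design on $\mathbb S^{n-1}$ of size $N$ with maximal inner product $s=s(C)\in[-1,1)$, and assume that $N_1:=L_\tau(n,s)$ satisfies $D(n,\tau)<N_1\le D(n,\tau+1)$. Then $f_\tau^{(n,s)}$ has exactly $k+\varepsilon$ distinct real roots $\alpha_0^{(n,s)}<\dots<\alpha_{k-1+\varepsilon}^{(n,s)}=s$, all of them in $[-1,s]$, and the multiset $T$ of its real roots, counted with multiplicity, has $\tau$ elements. Let $g_T$ be the Hermite interpolating polynomial of $h$ at $T$, i.e. the unique polynomial of degree less than $\tau$ that agrees at each point of $T$ with $h$ and with the derivatives of $h$ of order less than the multiplicity of that point, and let $$\rho_i^{(n,s)}=(\ell_i)_0-\frac{\ell_i(1)}{N_1},\qquad \ell_i(t)=\prod_{j\ne i}\frac{t-\alpha_j^{(n,s)}}{\alpha_i^{(n,s)}-\alpha_j^{(n,s)}}.$$ Then $$E_h(C,W)\le\frac{(N_W-N_1)\,g_T(1)}{N_WN_1}+\sum_{i=0}^{k-1+\varepsilon}\rho_i^{(n,s)}\,h\big(\alpha_i^{(n,s)}\big).$$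 -/

import Mathlib

open Polynomial

noncomputable section

/-- The Jacobi polynomial `P_k^{(a,b)}`, normalized to take the value `1` at `t = 1`:
the hypergeometric polynomial `₂F₁(-k, k + a + b + 1; a + 1; (1 - t) / 2)`
(for `a, b > -1`). -/
def jacobiPoly (a b : ℝ) (k : ℕ) : ℝ[X] :=
  ∑ j ∈ Finset.range (k + 1),
    C ((ascPochhammer ℝ j).eval (-(k : ℝ)) * (ascPochhammer ℝ j).eval ((k : ℝ) + a + b + 1) /
        ((ascPochhammer ℝ j).eval (a + 1) * (j.factorial : ℝ))) *
      (C (1 / 2) * (1 - X)) ^ j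

/-- The Gegenbauer polynomial `P_k^{(n)}`: the Jacobi polynomial with both parameters equal to
`(n - 3) / 2`, normalized by `P_k^{(n)}(1) = 1`. -/
def gegenbauerPoly (n k : ℕ) : ℝ[X] :=
  jacobiPoly (((n : ℝ) - 3) / 2) (((n : ℝ) - 3) / 2) k

/-- The density `γ_n (1 - t ^ 2) ^ ((n - 3) / 2)` on `[-1, 1]` of the probability measure `μ_n`
with respect to which the Gegenbauer polynomials `P_k^{(n)}` are orthogonal. -/
def gegenbauerDensity (n : ℕ) (t : ℝ) : ℝ :=
  Real.Gamma ((n : ℝ) / 2) / (Real.sqrt Real.pi * Real.Gamma (((n : ℝ) - 1) / 2)) *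
    (1 - t ^ 2) ^ (((n : ℝ) - 3) / 2)

/-- The zeroth coefficient `f_0` of the expansion `f = ∑ f_i P_i^{(n)}`, that is,
`f_0 = ∫ f dμ_n`. -/
def gegenbauerCoeffZero (n : ℕ) (f : ℝ[X]) : ℝ :=
  ∫ t in (-1 : ℝ)..1, f.eval t * gegenbauerDensity n t

/-- The bound `D(n, m) = C(n + k - 2 + ε, n - 1) + C(n + k - 2, n - 1)`, where
`m = 2 k - 1 + ε` and `ε ∈ {0, 1}`, of Delsarte, Goethals and Seidel (for `n ≥ 2`, `m ≥ 1`). -/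
def dgsBound (n m : ℕ) : ℕ :=
  (n + (m + 1) / 2 - 2 + (m + 1) % 2).choose (n - 1) + (n + (m + 1) / 2 - 2).choose (n - 1)

/-- The Levenshtein bound `L_m(n, s)`, `m = 2 k - 1 + ε`. -/
def levenshteinBound (n k ε : ℕ) (s : ℝ) : ℝ :=
  ((k + n - 3 + ε).choose (n - 2) : ℝ) *
    ((2 * (k : ℝ) + n - 3 + 2 * ε) / ((n : ℝ) - 1) -
      (1 + s) ^ ε * ((gegenbauerPoly n (k - 1 + ε)).eval s - (gegenbauerPoly n (k + ε)).eval s) /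
        ((1 - s) * (ε * (gegenbauerPoly n k).eval s + (gegenbauerPoly n (k + ε)).eval s)))

/-- The adjacent polynomials `P_i^{1,ε}`: the Jacobi polynomials with parameters
`1 + (n - 3) / 2` and `ε + (n - 3) / 2`, orthogonal with respect to `(1 - t) (1 + t) ^ ε dμ_n`. -/
def adjacentPoly (n ε i : ℕ) : ℝ[X] :=
  jacobiPoly (1 + ((n : ℝ) - 3) / 2) (ε + ((n : ℝ) - 3) / 2) i

/-- The Christoffel-Darboux kernel `T_{k-1}^{1,ε}(t, s) = ∑_{i < k} r_i P_i^{1,ε}(t) P_i^{1,ε}(s)`,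
as a polynomial in `t`, where `1 / r_i = ∫ (P_i^{1,ε}(t)) ^ 2 (1 - t) (1 + t) ^ ε dμ_n(t)`. -/
def levenshteinKernel (n k ε : ℕ) (s : ℝ) : ℝ[X] :=
  ∑ i ∈ Finset.range k,
    C ((adjacentPoly n ε i).eval s /
        ∫ t in (-1 : ℝ)..1,
          (adjacentPoly n ε i).eval t ^ 2 * ((1 - t) * (1 + t) ^ ε * gegenbauerDensity n t)) *
      adjacentPoly n ε i

/-- The Levenshtein polynomial `f_m^{(n,s)}(t) = (t - s) (t + 1) ^ ε (T_{k-1}^{1,ε}(t, s)) ^ 2`,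
`m = 2 k - 1 + ε` (up to a positive constant factor, on which nothing below depends). -/
def levenshteinPoly (n k ε : ℕ) (s : ℝ) : ℝ[X] :=
  (X - C s) * (X + 1) ^ ε * levenshteinKernel n k ε s ^ 2

/-- The multiset `T` of the roots of the Levenshtein polynomial, counted with multiplicity. -/
def interpolationNodes (n k ε : ℕ) (s : ℝ) : Multiset ℝ :=
  (levenshteinPoly n k ε s).roots

/-- The set of the nodes `α_i^{(n,s)}`: the distinct roots of the Levenshtein polynomial. -/
def levenshteinNodes (n k ε : ℕ) (s : ℝ) : Finset ℝ :=
  (interpolationNodes n k ε s).toFinset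

/-- The weight `ρ_i^{(n,s)}` at the node `α = α_i^{(n,s)}`, found by substituting the
Lagrange basis polynomial `ℓ` of the nodes (with `ℓ(α) = 1`) in the quadrature formula
`f_0 = f(1) / L_m(n, s) + ∑ ρ_i f(α_i)`. -/
def levenshteinWeight (n k ε : ℕ) (s α : ℝ) : ℝ :=
  gegenbauerCoeffZero n (Lagrange.basis (levenshteinNodes n k ε s) id α) -
    (Lagrange.basis (levenshteinNodes n k ε s) id α).eval 1 / levenshteinBound n k ε s

/-- `g` is the Hermite interpolating polynomial of `h` at the multiset `T`: its degree is less than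
the size of `T`, and at each point `t` of `T` it agrees with `h` together with the derivatives
of order less than the multiplicity of `t` in `T`. -/
def IsHermiteInterpolant (h : ℝ → ℝ) (T : Multiset ℝ) (g : ℝ[X]) : Prop :=
  g.degree < (Multiset.card T : WithBot ℕ) ∧
    ∀ t ∈ T, ∀ j < T.count t, (derivative^[j] g).eval t = iteratedDeriv j h t

/-- A weighted spherical code `(C, W)` of size `N` on the unit sphere of `ℝⁿ`: distinct points
with positive weights of sum `1`. -/
structure WeightedCode (n N : ℕ) where
  point : Fin N → EuclideanSpace ℝ (Fin n)
  weight : Fin N → ℝ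
  norm_point : ∀ i, ‖point i‖ = 1
  point_injective : Function.Injective point
  weight_pos : ∀ i, 0 < weight i
  sum_weight : ∑ i, weight i = 1

namespace WeightedCode

variable {n N : ℕ}

/-- The weighted `h`-energy `E_h(C, W) = ∑_{i ≠ j} w_i w_j h(x_i · x_j)`. -/
def energy (c : WeightedCode n N) (h : ℝ → ℝ) : ℝ :=
  ∑ i, ∑ j ∈ Finset.univ.erase i,
    c.weight i * c.weight j * h (inner ℝ (c.point i) (c.point j))

/-- The weighted moment `M_ℓ(C, W)`. -/
def moment (c : WeightedCode n N) (l : ℕ) : ℝ :=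
  ∑ i, ∑ j, c.weight i * c.weight j *
    (gegenbauerPoly n l).eval (inner ℝ (c.point i) (c.point j))

/-- Weighted spherical `τ`-designs. -/
def IsDesign (c : WeightedCode n N) (τ : ℕ) : Prop :=
  ∀ l, 1 ≤ l → l ≤ τ → c.moment l = 0

/-- `s` is the maximal inner product `s(C)` of pairs of distinct points. -/
def IsMaxInner (c : WeightedCode n N) (s : ℝ) : Prop :=
  IsGreatest {r | ∃ i j, i ≠ j ∧ r = inner ℝ (c.point i) (c.point j)} s

/-- `N_W = 1 / ∑ w_i ^ 2`. -/
def effectiveSize (c : WeightedCode n N) : ℝ :=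
  1 / ∑ i, c.weight i ^ 2

end WeightedCode

end

/-!
Average a polynomial over the inner products of all pairs of points of a design of strength `τ`: in
degree at most `τ` the result is the mean against `μ_n`, so a polynomial `g ≥ h` on `[-1, s]` bounds
the energy by `g_0 - g(1) / N_W`. The Hermite interpolant of `h` at the roots of the Levenshtein
polynomial `f` is such a majorant, because `f ≤ 0` on `[-1, s]`, and the Levenshtein quadrature
`g_0 = g(1) / N₁ + ∑ ρ_i g(α_i)`, exact in degree less than `τ`, gives the asserted form.

The nodes are located by positivity: for `u ≥ 0` on `[-1, 1]` of degree less than `τ - 1` the design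
yields `∫ (s - t) (1 - t) u dμ_n ≥ 0`. If this integral vanished for `u = (1 + t) ^ (1 - ε) q ^ 2`,
then `q` would be orthogonal to all polynomials of its degree, which forces
`L_τ(n, s) ≤ D(n, τ)`. The resulting strict positivity makes the Christoffel-Darboux kernel an
orthogonal polynomial of full degree, with simple roots inside `(-1, s)`.
-/

section PolynomialGeneralities

variable {K : Type*} [Field K]

theorem degree_mul_lt_iff {p q : K[X]} {d k : ℕ} (hp : p.degree = d) :
    (p * q).degree < (d + k : ℕ) ↔ q.degree < k := by
  rw [degree_mul, hp, Nat.cast_add]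
  exact WithBot.add_lt_add_iff_left (WithBot.natCast_ne_bot d)

theorem degree_C_mul_lt {q : K[X]} (a : K) {k : WithBot ℕ} (hq : q.degree < k) :
    (C a * q).degree < k := by
  rw [← smul_eq_C_mul]
  exact (degree_smul_le a q).trans_lt hq

theorem exists_eq_C_add_X_sub_C_mul {q : K[X]} (a : K) {k : ℕ} (hq : q.degree < (1 + k : ℕ)) :
    ∃ r : K[X], q = C (q.eval a) + (X - C a) * r ∧ r.degree < k := by
  obtain ⟨r, hr⟩ := X_sub_C_dvd_sub_C_eval (p := q) (a := a)
  refine ⟨r, by rw [← hr, add_sub_cancel], (degree_mul_lt_iff (degree_X_sub_C a)).1 ?_⟩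
  rw [← hr]
  refine (degree_sub_le _ _).trans_lt (max_lt hq (degree_C_le.trans_lt ?_))
  exact_mod_cast Nat.add_pos_left one_pos k

theorem exists_degree_sub_C_mul_lt {p q : K[X]} {k : ℕ} (hq : q.degree < (k + 1 : ℕ))
    (hp : p.degree = k) : ∃ a : K, (q - C a * p).degree < k := by
  have hlead : p.coeff k ≠ 0 := coeff_ne_zero_of_eq_degree hp
  refine ⟨q.coeff k / p.coeff k, (degree_lt_iff_coeff_zero _ _).2 fun m hm => ?_⟩
  rw [coeff_sub, coeff_C_mul]
  rcases hm.lt_or_eq with hlt | heq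
  · have hpm : p.degree < m := hp.trans_lt (by exact_mod_cast hlt)
    rw [(degree_lt_iff_coeff_zero _ _).1 hq m hlt, coeff_eq_zero_of_degree_lt hpm, mul_zero,
      sub_zero]
  · rw [← heq, div_mul_cancel₀ _ hlead, sub_self]

variable {M : Type*} [AddCommGroup M] [Module K M]

theorem linearMap_eq_zero_of_degree_lt (S : Polynomial.Sequence K) (φ : K[X] →ₗ[K] M) {k : ℕ}
    (h : ∀ i < k, φ (S i) = 0) {q : K[X]} (hq : q.degree < k) : φ q = 0 := by
  suffices hle : degreeLT K k ≤ LinearMap.ker φ from hle (mem_degreeLT.2 hq)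
  rw [← S.span_degreeLT fun i _ => (leadingCoeff_ne_zero.2 (S.ne_zero i)).isUnit,
    Submodule.span_le]
  rintro _ ⟨i, hi, rfl⟩
  exact h i hi

theorem linearMap_C_mul (φ : K[X] →ₗ[K] M) (a : K) (q : K[X]) : φ (C a * q) = a • φ q := by
  rw [← smul_eq_C_mul, map_smul]

theorem linearMap_kernel_mul (S : Polynomial.Sequence K) (φ : K[X] →ₗ[K] K)
    (horth : ∀ (i : ℕ) (q : K[X]), q.degree < i → φ (S i * q) = 0)
    (hne : ∀ i, φ (S i ^ 2) ≠ 0) (s : K) {k : ℕ} {q : K[X]} (hq : q.degree < k) :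
    φ ((∑ i ∈ Finset.range k, C ((S i).eval s / φ (S i ^ 2)) * S i) * q) = q.eval s := by
  rw [← leval_apply (R := K), ← sub_eq_zero]
  refine linearMap_eq_zero_of_degree_lt S (φ ∘ₗ LinearMap.mulLeft K _ - leval s)
    (fun j hj => ?_) hq
  have hoff : ∀ i ∈ Finset.range k, i ≠ j →
      φ (C ((S i).eval s / φ (S i ^ 2)) * S i * S j) = 0 := by
    intro i _ hij
    rw [mul_assoc, linearMap_C_mul]
    rcases hij.lt_or_gt with hlt | hgt
    · rw [mul_comm (S i), horth j _ (by rw [S.degree_eq]; exact_mod_cast hlt), smul_zero]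
    · rw [horth i _ (by rw [S.degree_eq]; exact_mod_cast hgt), smul_zero]
  rw [LinearMap.sub_apply, LinearMap.comp_apply, LinearMap.mulLeft_apply, leval_apply,
    Finset.sum_mul, map_sum, Finset.sum_eq_single_of_mem j (Finset.mem_range.2 hj) hoff,
    mul_assoc, linearMap_C_mul, ← sq, smul_eq_mul, div_mul_cancel₀ _ (hne j), sub_self]

/-- The polynomials `(a + X) ^ m`, as a sequence. -/
noncomputable def shiftedPowers (a : K) : Polynomial.Sequence K where
  elems' m := (C a + X) ^ m
  degree_eq' m := by rw [degree_pow, add_comm, degree_X_add_C, nsmul_one]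

end PolynomialGeneralities

/-! ### The Jacobi weight -/

open MeasureTheory Set

/-- The weight `(1 - t) ^ a * (1 + t) ^ b` on `[-1, 1]`. -/
noncomputable def jacobiWeight (a b t : ℝ) : ℝ :=
  (1 - t) ^ a * (1 + t) ^ b

theorem ae_mem_Ioo {a b : ℝ} (hab : a ≤ b) : ∀ᵐ t ∂volume.restrict (uIoc a b), t ∈ Ioo a b := by
  rw [uIoc_of_le hab, ← Measure.restrict_congr_set Ioo_ae_eq_Ioc]
  exact ae_restrict_mem measurableSet_Ioo

theorem jacobiWeight_pos (a b : ℝ) {t : ℝ} (ht : t ∈ Ioo (-1 : ℝ) 1) :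
    0 < jacobiWeight a b t :=
  mul_pos (Real.rpow_pos_of_pos (by linarith [ht.2]) _)
    (Real.rpow_pos_of_pos (by linarith [ht.1]) _)

theorem integral_jacobiWeight {a b : ℝ} (ha : -1 < a) (hb : -1 < b) :
    ∫ t in (-1 : ℝ)..1, jacobiWeight a b t =
      2 ^ (a + b + 1) * ProbabilityTheory.beta (a + 1) (b + 1) := by
  have hshift : ∫ t in (-1 : ℝ)..1, jacobiWeight a b t =
      ∫ u in (0 : ℝ)..2, u ^ a * (2 - u) ^ b := by
    have h := intervalIntegral.integral_comp_sub_left (fun u : ℝ => u ^ a * (2 - u) ^ b) 1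
      (a := -1) (b := 1)
    norm_num [← sub_add] at h
    simpa only [jacobiWeight] using h
  have hcast : ∀ u ∈ uIcc (0 : ℝ) 2,
      (u : ℂ) ^ (((a + 1 : ℝ) : ℂ) - 1) * (((2 : ℝ) : ℂ) - u) ^ (((b + 1 : ℝ) : ℂ) - 1) =
        ((u ^ a * (2 - u) ^ b : ℝ) : ℂ) := by
    intro u hu
    rw [uIcc_of_le zero_le_two] at hu
    push_cast
    rw [Complex.ofReal_cpow hu.1, Complex.ofReal_cpow (sub_nonneg.2 hu.2)]
    simp
  have hbeta := Complex.betaIntegral_scaled ((a + 1 : ℝ) : ℂ) ((b + 1 : ℝ) : ℂ) two_pos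
  rw [intervalIntegral.integral_congr hcast, intervalIntegral.integral_ofReal, ← hshift,
    show ((a + 1 : ℝ) : ℂ) + ((b + 1 : ℝ) : ℂ) - 1 = ((a + b + 1 : ℝ) : ℂ) by push_cast; ring,
    ← Complex.ofReal_cpow zero_le_two] at hbeta
  have hre := congrArg Complex.re hbeta
  rwa [Complex.ofReal_re, Complex.re_ofReal_mul,
    ← ProbabilityTheory.beta_eq_betaIntegralReal _ _ (by linarith) (by linarith)] at hre

theorem intervalIntegrable_jacobiWeight {a b : ℝ} (ha : -1 < a) (hb : -1 < b) :
    IntervalIntegrable (jacobiWeight a b) volume (-1) 1 := by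
  refine intervalIntegral.intervalIntegrable_of_integral_ne_zero ?_
  rw [integral_jacobiWeight ha hb]
  have := ProbabilityTheory.beta_pos (neg_lt_iff_pos_add.1 ha) (neg_lt_iff_pos_add.1 hb)
  positivity

theorem intervalIntegrable_eval_mul_jacobiWeight {a b : ℝ} (ha : -1 < a) (hb : -1 < b)
    (f : ℝ[X]) :
    IntervalIntegrable (fun t => f.eval t * jacobiWeight a b t) volume (-1) 1 :=
  (intervalIntegrable_jacobiWeight ha hb).continuousOn_mul f.continuous.continuousOn

theorem Gamma_add_natCast {x : ℝ} (hx : 0 < x) (j : ℕ) :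
    Real.Gamma (x + j) = (ascPochhammer ℝ j).eval x * Real.Gamma x := by
  induction j with
  | zero => simp
  | succ j ih =>
    rw [ascPochhammer_succ_eval, Nat.cast_succ, ← add_assoc, Real.Gamma_add_one (by positivity), ih]
    ring

theorem beta_add_natCast {x y : ℝ} (hx : 0 < x) (hy : 0 < y) (j : ℕ) :
    ProbabilityTheory.beta (x + j) y =
      (ascPochhammer ℝ j).eval x / (ascPochhammer ℝ j).eval (x + y) *
        ProbabilityTheory.beta x y := by
  simp only [ProbabilityTheory.beta]
  rw [add_right_comm, Gamma_add_natCast hx, Gamma_add_natCast (add_pos hx hy)]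
  have := (ascPochhammer_pos j (x + y) (add_pos hx hy)).ne'
  have := (Real.Gamma_pos_of_pos (add_pos hx hy)).ne'
  field_simp

/-- The linear functional `f ↦ ∫ f(t) (1 - t) ^ a (1 + t) ^ b dt` on polynomials. -/
noncomputable def jacobiIntegral {a b : ℝ} (ha : -1 < a) (hb : -1 < b) : ℝ[X] →ₗ[ℝ] ℝ where
  toFun f := ∫ t in (-1 : ℝ)..1, f.eval t * jacobiWeight a b t
  map_add' f g := by
    simp only [eval_add, add_mul]
    exact intervalIntegral.integral_add (intervalIntegrable_eval_mul_jacobiWeight ha hb f)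
      (intervalIntegrable_eval_mul_jacobiWeight ha hb g)
  map_smul' r f := by
    simp only [eval_smul, smul_eq_mul, mul_assoc, intervalIntegral.integral_const_mul,
      RingHom.id_apply]

section JacobiIntegral

variable {a b : ℝ} (ha : -1 < a) (hb : -1 < b)

theorem jacobiIntegral_apply (f : ℝ[X]) :
    jacobiIntegral ha hb f = ∫ t in (-1 : ℝ)..1, f.eval t * jacobiWeight a b t := rfl

theorem jacobiIntegral_pos {f : ℝ[X]} (hf : ∀ t ∈ Ioo (-1 : ℝ) 1, 0 ≤ f.eval t) (h0 : f ≠ 0) :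
    0 < jacobiIntegral ha hb f := by
  rw [jacobiIntegral_apply, intervalIntegral.integral_pos_iff_support_of_nonneg_ae'
    ((ae_mem_Ioo (by norm_num)).mono fun t ht => mul_nonneg (hf t ht) (jacobiWeight_pos a b ht).le)
    (intervalIntegrable_eval_mul_jacobiWeight ha hb f)]
  have hsupp : Ioo (-1 : ℝ) 1 \ (f.roots.toFinset : Set ℝ) ⊆
      Function.support (fun t => f.eval t * jacobiWeight a b t) ∩ Ioc (-1) 1 := by
    rintro t ⟨ht, hroot⟩
    have hne : f.eval t ≠ 0 := by simpa [h0] using hroot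
    exact ⟨mul_ne_zero hne (jacobiWeight_pos a b ht).ne', ht.1, ht.2.le⟩
  refine ⟨by norm_num, lt_of_lt_of_le ?_ (measure_mono hsupp)⟩
  rw [measure_sdiff_null (Finset.measure_zero _ _), Real.volume_Ioo]
  norm_num

theorem jacobiIntegral_mul_pow {a' b' : ℝ} (ha' : -1 < a') (hb' : -1 < b') (u v : ℕ)
    (hu : a' = a + u) (hv : b' = b + v) (f : ℝ[X]) :
    jacobiIntegral ha hb (f * ((1 - X) ^ u * (1 + X) ^ v)) = jacobiIntegral ha' hb' f := by
  subst hu hv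
  refine intervalIntegral.integral_congr_ae_restrict
    ((ae_mem_Ioo (by norm_num)).mono fun t ht => ?_)
  simp only [jacobiWeight, eval_mul, eval_pow, eval_sub, eval_add, eval_one, eval_X,
    Real.rpow_add_natCast (sub_pos.2 ht.2).ne',
    Real.rpow_add_natCast (neg_lt_iff_pos_add'.1 ht.1).ne']
  ring

theorem jacobiIntegral_one_sub_X_pow_mul (j m : ℕ) :
    jacobiIntegral ha hb ((1 - X) ^ j * (1 + X) ^ m) =
      2 ^ j * ((ascPochhammer ℝ j).eval (a + 1) / (ascPochhammer ℝ j).eval (a + b + 2 + m)) *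
        jacobiIntegral ha hb ((1 + X) ^ m) := by
  have hj : -1 < a + j := ha.trans_le (le_add_of_nonneg_right j.cast_nonneg)
  have hm : -1 < b + m := hb.trans_le (le_add_of_nonneg_right m.cast_nonneg)
  have hleft := jacobiIntegral_mul_pow ha hb hj hm j m rfl rfl 1
  have hright := jacobiIntegral_mul_pow ha hb ha hm 0 m (by simp) rfl 1
  simp only [pow_zero, one_mul, jacobiIntegral_apply _ _ (1 : ℝ[X]), eval_one] at hleft hright
  rw [hleft, integral_jacobiWeight hj hm, hright, integral_jacobiWeight ha hm,
    show a + j + 1 = a + 1 + j by ring, beta_add_natCast (by linarith) (by linarith),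
    show a + j + (b + m) + 1 = a + (b + m) + 1 + j by ring,
    Real.rpow_add_natCast two_ne_zero, show a + 1 + (b + m + 1) = a + b + 2 + m by ring]
  ring

end JacobiIntegral

/-! ### Jacobi polynomials -/

theorem ascPochhammer_eval_add_index {S : Type*} [CommSemiring S] (i j : ℕ) (x : S) :
    (ascPochhammer S (i + j)).eval x =
      (ascPochhammer S i).eval x * (ascPochhammer S j).eval (x + i) := by
  rw [← ascPochhammer_mul, eval_mul, eval_comp]
  simp

theorem ascPochhammer_eval_neg_natCast {R : Type*} [CommRing R] (k j : ℕ) :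
    (ascPochhammer R j).eval (-(k : R)) = (-1) ^ j * (j.factorial * k.choose j) := by
  rw [ascPochhammer_eval_neg_eq_descPochhammer, descPochhammer_eval_eq_descFactorial,
    Nat.descFactorial_eq_factorial_mul_choose, Nat.cast_mul]

theorem sum_neg_one_pow_mul_choose_mul_eval {k : ℕ} {Q : ℝ[X]} (hQ : Q.natDegree < k) (y : ℝ) :
    ∑ j ∈ Finset.range (k + 1), (-1 : ℝ) ^ j * k.choose j * Q.eval (y + j) = 0 := by
  have hdiff := congr_fun (fwdDiff_iter_eq_zero_of_degree_lt hQ) y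
  rw [fwdDiff_iter_eq_sum_shift] at hdiff
  have hsign : ∀ j ∈ Finset.range (k + 1), (-1 : ℝ) ^ j * k.choose j * Q.eval (y + j) =
      (-1) ^ k * (((-1 : ℤ) ^ (k - j) * (k.choose j : ℤ)) • Q.eval (y + j • 1)) := by
    intro j hj
    obtain ⟨d, rfl⟩ := Nat.exists_eq_add_of_le (Nat.lt_succ_iff.1 (Finset.mem_range.1 hj))
    have hd : (-1 : ℝ) ^ d * (-1) ^ d = 1 := by rw [← mul_pow]; simp
    rw [Nat.add_sub_cancel_left, zsmul_eq_mul, nsmul_one, pow_add]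
    push_cast
    linear_combination (-((-1 : ℝ) ^ j * (j + d).choose j * Q.eval (y + j))) * hd
  rw [Finset.sum_congr rfl hsign, ← Finset.mul_sum, hdiff, Pi.zero_apply, mul_zero]

/-- The coefficients of the Jacobi polynomials in the powers of `(1 - X) / 2`. -/
noncomputable def jacobiCoeff (a b : ℝ) (k j : ℕ) : ℝ :=
  (ascPochhammer ℝ j).eval (-(k : ℝ)) * (ascPochhammer ℝ j).eval ((k : ℝ) + a + b + 1) /
    ((ascPochhammer ℝ j).eval (a + 1) * (j.factorial : ℝ))

theorem jacobiCoeff_zero_right (a b : ℝ) (k : ℕ) : jacobiCoeff a b k 0 = 1 := by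
  simp [jacobiCoeff]

theorem jacobiCoeff_eq_zero_of_lt {k j : ℕ} (a b : ℝ) (h : k < j) : jacobiCoeff a b k j = 0 := by
  rw [jacobiCoeff, ascPochhammer_eval_neg_coe_nat_of_lt h, zero_mul, zero_div]

theorem jacobiCoeff_self_ne_zero {a b : ℝ} (ha : -1 < a) (hb : -1 < b) (k : ℕ) :
    jacobiCoeff a b k k ≠ 0 := by
  have hden := (ascPochhammer_pos k (a + 1) (by linarith)).ne'
  have hnum : (ascPochhammer ℝ k).eval ((k : ℝ) + a + b + 1) ≠ 0 := by
    rcases k with _ | k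
    · simp
    · exact (ascPochhammer_pos _ _ (by push_cast; linarith [k.cast_nonneg (α := ℝ)])).ne'
  rw [jacobiCoeff, ascPochhammer_eval_neg_natCast, Nat.choose_self]
  positivity

/-- The hypergeometric polynomial `₂F₁(-k, k + a + b + 1; a + 1; X)`, which becomes the Jacobi
polynomial under the substitution `X = (1 - t) / 2`. -/
noncomputable def jacobiHypergeometric (a b : ℝ) (k : ℕ) : ℝ[X] :=
  ∑ j ∈ Finset.range (k + 1), C (jacobiCoeff a b k j) * X ^ j

theorem jacobiHypergeometric_coeff (a b : ℝ) (k j : ℕ) :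
    (jacobiHypergeometric a b k).coeff j = jacobiCoeff a b k j := by
  simp only [jacobiHypergeometric, finsetSum_coeff, coeff_C_mul_X_pow, Finset.sum_ite_eq,
    Finset.mem_range, Nat.lt_succ_iff, ite_eq_left_iff, not_le]
  exact fun h => (jacobiCoeff_eq_zero_of_lt a b h).symm

theorem jacobiPoly_eq_sum (a b : ℝ) (k : ℕ) :
    jacobiPoly a b k =
      ∑ j ∈ Finset.range (k + 1), C (jacobiCoeff a b k j) * (C (1 / 2) * (1 - X)) ^ j := rfl

theorem jacobiPoly_eq_comp (a b : ℝ) (k : ℕ) :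
    jacobiPoly a b k = (jacobiHypergeometric a b k).comp (C (1 / 2) * (1 - X)) := by
  simp only [jacobiPoly_eq_sum, jacobiHypergeometric, Polynomial.sum_comp, mul_comp, C_comp,
    X_pow_comp]

theorem jacobiPoly_zero (a b : ℝ) : jacobiPoly a b 0 = 1 := by
  simp [jacobiPoly]

theorem jacobiPoly_eval_one (a b : ℝ) (k : ℕ) : (jacobiPoly a b k).eval 1 = 1 := by
  rw [jacobiPoly_eq_comp, eval_comp]
  simp [← coeff_zero_eq_eval_zero, jacobiHypergeometric_coeff, jacobiCoeff_zero_right]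

theorem jacobiPoly_degree {a b : ℝ} (ha : -1 < a) (hb : -1 < b) (k : ℕ) :
    (jacobiPoly a b k).degree = k := by
  have hcoeff : (jacobiHypergeometric a b k).coeff k ≠ 0 := by
    rw [jacobiHypergeometric_coeff]
    exact jacobiCoeff_self_ne_zero ha hb k
  have hnatDegree : (jacobiHypergeometric a b k).natDegree = k := by
    refine natDegree_eq_of_le_of_coeff_ne_zero ?_ hcoeff
    refine natDegree_le_iff_coeff_eq_zero.2 fun j hj => ?_
    rw [jacobiHypergeometric_coeff, jacobiCoeff_eq_zero_of_lt a b hj]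
  have hlin : (C (1 / 2) * (1 - X) : ℝ[X]).natDegree = 1 := by
    rw [natDegree_C_mul (by norm_num), ← natDegree_neg, neg_sub, ← C_1, natDegree_X_sub_C]
  have hcomp : (jacobiPoly a b k).natDegree = k := by
    rw [jacobiPoly_eq_comp, natDegree_comp, hlin, hnatDegree, mul_one]
  rw [degree_eq_natDegree (fun h0 => by simpa [h0] using jacobiPoly_eval_one a b k), hcomp]

/-- By the beta integral, the `j`-th term of `jacobiPoly a b k` contributes a binomial coefficient
times a polynomial of degree `k - m - 1` in `j`, so the sum is a vanishing `k`-th difference. -/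
theorem jacobiIntegral_jacobiPoly_mul_pow {a b : ℝ} (ha : -1 < a) (hb : -1 < b) {k m : ℕ}
    (hm : m < k) : jacobiIntegral ha hb (jacobiPoly a b k * (1 + X) ^ m) = 0 := by
  obtain ⟨d, rfl⟩ := Nat.exists_eq_add_of_lt hm
  set y : ℝ := a + b + 2 + m with hy_def
  have hy : 0 < y := by linarith [m.cast_nonneg (α := ℝ)]
  have hterm : ∀ j ∈ Finset.range (m + d + 1 + 1),
      jacobiIntegral ha hb (C (jacobiCoeff a b (m + d + 1) j) * (C (1 / 2) * (1 - X)) ^ j *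
        (1 + X) ^ m) =
      jacobiIntegral ha hb ((1 + X) ^ m) / (ascPochhammer ℝ d).eval y *
        ((-1) ^ j * (m + d + 1).choose j * (ascPochhammer ℝ d).eval (y + j)) := by
    intro j _
    have hexchange : (ascPochhammer ℝ j).eval y * (ascPochhammer ℝ d).eval (y + j) =
        (ascPochhammer ℝ d).eval y * (ascPochhammer ℝ j).eval (y + d) := by
      rw [← ascPochhammer_eval_add_index, ← ascPochhammer_eval_add_index, add_comm]
    rw [mul_pow, ← C_pow, ← mul_assoc, ← C_mul, mul_assoc, ← smul_eq_C_mul, map_smul, smul_eq_mul,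
      jacobiIntegral_one_sub_X_pow_mul, ← hy_def, jacobiCoeff, ascPochhammer_eval_neg_natCast,
      show ((m + d + 1 : ℕ) : ℝ) + a + b + 1 = y + d by rw [hy_def]; push_cast; ring]
    have := ascPochhammer_pos d y hy
    have := ascPochhammer_pos j y hy
    have := ascPochhammer_pos j (a + 1) (by linarith)
    have := j.factorial_pos
    rw [one_div, inv_pow]
    field_simp
    linear_combination (-(jacobiIntegral ha hb ((1 + X) ^ m)) *
      ((m + d + 1).choose j : ℝ)) * hexchange
  rw [jacobiPoly_eq_sum, Finset.sum_mul, map_sum, Finset.sum_congr rfl hterm, ← Finset.mul_sum,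
    sum_neg_one_pow_mul_choose_mul_eval (by rw [ascPochhammer_natDegree]; lia), mul_zero]

theorem jacobiIntegral_jacobiPoly_mul {a b : ℝ} (ha : -1 < a) (hb : -1 < b) {k : ℕ} {q : ℝ[X]}
    (hq : q.degree < k) : jacobiIntegral ha hb (jacobiPoly a b k * q) = 0 :=
  linearMap_eq_zero_of_degree_lt (shiftedPowers 1)
    (jacobiIntegral ha hb ∘ₗ LinearMap.mulLeft ℝ (jacobiPoly a b k))
    (fun _ hm => jacobiIntegral_jacobiPoly_mul_pow ha hb hm) hq

/-! ### The ultraspherical recurrence -/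

theorem jacobiCoeff_recurrence {a : ℝ} (ha : -1 < a) (k j : ℕ) :
    ((k : ℝ) + 2 * a + 2) * jacobiCoeff a a (k + 2) (j + 1) =
      (2 * k + 2 * a + 3) * (jacobiCoeff a a (k + 1) (j + 1) - 2 * jacobiCoeff a a (k + 1) j) -
        (k + 1) * jacobiCoeff a a k (j + 1) := by
  have hleft (x : ℝ) (i : ℕ) : (ascPochhammer ℝ (i + 1)).eval x =
      x * (ascPochhammer ℝ i).eval (x + 1) := by
    rw [add_comm, ascPochhammer_eval_add_index]; simp
  have ha' : 0 < a + 1 := by linarith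
  have := ascPochhammer_pos j (a + 1) ha'
  have := j.factorial_pos
  have : 0 < a + 1 + j := by positivity
  set x : ℝ := k + 2 * a + 2 with hx
  set A := (ascPochhammer ℝ j).eval (-((k : ℝ) + 1)) with hA
  set B := (ascPochhammer ℝ j).eval x with hB
  have hA₁ : (ascPochhammer ℝ (j + 1)).eval (-((k : ℝ) + 1)) = A * (j - (k + 1)) := by
    rw [ascPochhammer_succ_eval, ← hA]; ring
  have hA₂ : (ascPochhammer ℝ (j + 1)).eval (-((k : ℝ) + 2)) = -(k + 2) * A := by
    rw [hleft, hA]; ring_nf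
  have hA₀ : (k + 1) * (ascPochhammer ℝ (j + 1)).eval (-(k : ℝ)) =
      -(A * (j - (k + 1)) * (j - k)) := by
    have h := hleft (-((k : ℝ) + 1)) (j + 1)
    rw [ascPochhammer_succ_eval, hA₁, show -((k : ℝ) + 1) + 1 = -k by ring] at h
    push_cast at h
    linear_combination h
  have hB₁ : (ascPochhammer ℝ (j + 1)).eval x = B * (x + j) := by
    rw [ascPochhammer_succ_eval]
  have hB₂ : x * (ascPochhammer ℝ (j + 1)).eval (x + 1) = B * (x + j) * (x + j + 1) := by
    rw [← hleft, ascPochhammer_succ_eval, hB₁]; push_cast; ring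
  have hB₀ : (ascPochhammer ℝ (j + 1)).eval (x - 1) = (x - 1) * B := by
    rw [hleft, sub_add_cancel]
  simp only [jacobiCoeff]
  push_cast
  rw [show (k : ℝ) + 2 + a + a + 1 = x + 1 by rw [hx]; ring,
    show (k : ℝ) + 1 + a + a + 1 = x by rw [hx]; ring,
    show (k : ℝ) + a + a + 1 = x - 1 by rw [hx]; ring,
    show 2 * (k : ℝ) + 2 * a + 3 = x + k + 1 by rw [hx]; ring,
    hA₁, hA₂, hB₁, hB₀, ← hA, ← hB, ascPochhammer_succ_eval j (a + 1), Nat.factorial_succ]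
  push_cast
  field_simp
  rw [show a = (x - k - 2) / 2 by rw [hx]; ring]
  linear_combination (-((k : ℝ) + 2) * A) * hB₂ + ((x - 1) * B) * hA₀

theorem jacobiPoly_self_recurrence {a : ℝ} (ha : -1 < a) (k : ℕ) :
    C ((k : ℝ) + 2 * a + 2) * jacobiPoly a a (k + 2) =
      C (2 * (k : ℝ) + 2 * a + 3) * X * jacobiPoly a a (k + 1) -
        C ((k : ℝ) + 1) * jacobiPoly a a k := by
  have hseries : C ((k : ℝ) + 2 * a + 2) * jacobiHypergeometric a a (k + 2) =
      C (2 * (k : ℝ) + 2 * a + 3) * (1 - C 2 * X) * jacobiHypergeometric a a (k + 1) -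
        C ((k : ℝ) + 1) * jacobiHypergeometric a a k := by
    ext (_ | j) <;>
      simp only [mul_assoc, sub_mul, one_mul, coeff_sub, coeff_C_mul, coeff_X_mul, coeff_X_mul_zero,
        jacobiHypergeometric_coeff, jacobiCoeff_zero_right]
    · ring
    · exact jacobiCoeff_recurrence ha k j
  have hX : (1 - C 2 * (C (1 / 2) * (1 - X)) : ℝ[X]) = X := by
    rw [← mul_assoc, ← C_mul]
    norm_num
  have hcomp := congrArg (fun p => p.comp (C (1 / 2) * (1 - X))) hseries
  simpa only [mul_comp, sub_comp, one_comp, C_comp, X_comp, hX, ← jacobiPoly_eq_comp] using hcomp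

theorem jacobiPoly_self_one {a : ℝ} (ha : -1 < a) : jacobiPoly a a 1 = X := by
  have ha' : a + 1 ≠ 0 := by linarith
  have hcoeff : jacobiCoeff a a 1 1 = -2 := by
    simp only [jacobiCoeff, ascPochhammer_one, eval_X, Nat.factorial_one, Nat.cast_one]
    field_simp
    ring
  rw [jacobiPoly_eq_comp, jacobiHypergeometric, Finset.sum_range_succ, Finset.sum_range_one,
    jacobiCoeff_zero_right, hcoeff]
  simp only [pow_zero, pow_one, add_comp, mul_comp, C_comp, X_comp, one_comp, ← mul_assoc, ← C_mul]
  norm_num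

theorem jacobiPoly_self_eval_neg_one {a : ℝ} (ha : -1 < a) (k : ℕ) :
    (jacobiPoly a a k).eval (-1) = (-1) ^ k := by
  induction k using Nat.twoStepInduction with
  | zero => simp [jacobiPoly_zero]
  | one => simp [jacobiPoly_self_one ha]
  | more k ih₀ ih₁ =>
    have h := congrArg (eval (-1)) (jacobiPoly_self_recurrence ha k)
    simp only [eval_mul, eval_sub, eval_C, eval_X, ih₀, ih₁] at h
    refine mul_left_cancel₀ (?_ : (k : ℝ) + 2 * a + 2 ≠ 0) ?_
    · linarith [k.cast_nonneg (α := ℝ)]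
    · linear_combination h

/-! ### Gegenbauer polynomials -/

section Gegenbauer

variable {n : ℕ} (hn : 2 ≤ n)

include hn in
theorem neg_one_lt_half_sub_three : -1 < ((n : ℝ) - 3) / 2 := by
  have : (2 : ℝ) ≤ n := by exact_mod_cast hn
  linarith

/-- The constant `γ_n`, which makes `μ_n` a probability measure. -/
noncomputable def gegenbauerConst (n : ℕ) : ℝ :=
  Real.Gamma ((n : ℝ) / 2) / (Real.sqrt Real.pi * Real.Gamma (((n : ℝ) - 1) / 2))

include hn in
theorem gegenbauerConst_pos : 0 < gegenbauerConst n := by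
  have := neg_one_lt_half_sub_three hn
  have hnum := Real.Gamma_pos_of_pos (s := (n : ℝ) / 2) (by linarith)
  have hden := Real.Gamma_pos_of_pos (s := ((n : ℝ) - 1) / 2) (by linarith)
  exact div_pos hnum (by positivity)

/-- The mean `f ↦ ∫ f dμ_n` as a linear functional on polynomials. -/
noncomputable def gegenbauerMean : ℝ[X] →ₗ[ℝ] ℝ :=
  gegenbauerConst n •
    jacobiIntegral (neg_one_lt_half_sub_three hn) (neg_one_lt_half_sub_three hn)

theorem gegenbauerMean_apply (f : ℝ[X]) : gegenbauerMean hn f = gegenbauerCoeffZero n f := by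
  rw [gegenbauerMean, LinearMap.smul_apply, jacobiIntegral_apply, smul_eq_mul,
    ← intervalIntegral.integral_const_mul]
  refine intervalIntegral.integral_congr_ae_restrict
    ((ae_mem_Ioo (by norm_num)).mono fun t ht => ?_)
  simp only [jacobiWeight, gegenbauerDensity, gegenbauerConst]
  rw [← Real.mul_rpow (sub_pos.2 ht.2).le (neg_lt_iff_pos_add'.1 ht.1).le,
    show (1 - t) * (1 + t) = 1 - t ^ 2 by ring, mul_left_comm]

theorem gegenbauerMean_pos {f : ℝ[X]} (hf : ∀ t ∈ Ioo (-1 : ℝ) 1, 0 ≤ f.eval t) (h0 : f ≠ 0) :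
    0 < gegenbauerMean hn f :=
  mul_pos (gegenbauerConst_pos hn) (jacobiIntegral_pos _ _ hf h0)

theorem gegenbauerMean_one : gegenbauerMean hn 1 = 1 := by
  have ha := neg_one_lt_half_sub_three hn
  obtain ⟨c, hc⟩ : ∃ c, c = ((n : ℝ) - 1) / 2 := ⟨_, rfl⟩
  have hc0 : 0 < c := by linarith
  have hpow : (2 : ℝ) ^ (2 * c - 1) * 2 ^ (1 - 2 * c) = 1 := by
    rw [← Real.rpow_add two_pos]; norm_num
  have hdup := Real.Gamma_mul_Gamma_add_half c
  have := Real.Gamma_pos_of_pos hc0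
  have := Real.Gamma_pos_of_pos (mul_pos two_pos hc0)
  simp only [gegenbauerMean, LinearMap.smul_apply, jacobiIntegral_apply, eval_one, one_mul,
    integral_jacobiWeight ha ha, ProbabilityTheory.beta, gegenbauerConst, smul_eq_mul]
  rw [show ((n : ℝ) - 3) / 2 = c - 1 by rw [hc]; ring,
    show (n : ℝ) / 2 = c + 1 / 2 by rw [hc]; ring, ← hc, show c - 1 + 1 = c by ring,
    show c - 1 + (c - 1) + 1 = 2 * c - 1 by ring, show c + c = 2 * c by ring]
  generalize Real.Gamma (c + 1 / 2) = G at hdup ⊢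
  generalize (2 : ℝ) ^ (2 * c - 1) = p at hpow ⊢
  field_simp
  linear_combination p * hdup + Real.Gamma (2 * c) * √Real.pi * hpow

/-- The Gegenbauer polynomials as a sequence of polynomials of degrees `0, 1, 2, …`. -/
noncomputable def gegenbauerSequence : Polynomial.Sequence ℝ where
  elems' := gegenbauerPoly n
  degree_eq' := jacobiPoly_degree (neg_one_lt_half_sub_three hn) (neg_one_lt_half_sub_three hn)

include hn in
theorem gegenbauerPoly_degree (k : ℕ) : (gegenbauerPoly n k).degree = k :=
  (gegenbauerSequence hn).degree_eq k

theorem gegenbauerPoly_eval_one (n k : ℕ) : (gegenbauerPoly n k).eval 1 = 1 :=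
  jacobiPoly_eval_one _ _ _

include hn in
theorem gegenbauerPoly_eval_neg_one (k : ℕ) : (gegenbauerPoly n k).eval (-1) = (-1) ^ k :=
  jacobiPoly_self_eval_neg_one (neg_one_lt_half_sub_three hn) k

theorem gegenbauerPoly_zero (n : ℕ) : gegenbauerPoly n 0 = 1 :=
  jacobiPoly_zero _ _

include hn in
theorem gegenbauerPoly_one : gegenbauerPoly n 1 = X :=
  jacobiPoly_self_one (neg_one_lt_half_sub_three hn)

include hn in
theorem gegenbauerPoly_recurrence (k : ℕ) :
    C ((k : ℝ) + n - 1) * gegenbauerPoly n (k + 2) =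
      C (2 * (k : ℝ) + n) * X * gegenbauerPoly n (k + 1) -
        C ((k : ℝ) + 1) * gegenbauerPoly n k := by
  have h := jacobiPoly_self_recurrence (neg_one_lt_half_sub_three hn) k
  rwa [show (k : ℝ) + 2 * (((n : ℝ) - 3) / 2) + 2 = k + n - 1 by ring,
    show 2 * (k : ℝ) + 2 * (((n : ℝ) - 3) / 2) + 3 = 2 * k + n by ring] at h

theorem gegenbauerMean_gegenbauerPoly_mul {k : ℕ} {q : ℝ[X]} (hq : q.degree < k) :
    gegenbauerMean hn (gegenbauerPoly n k * q) = 0 := by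
  rw [gegenbauerMean, LinearMap.smul_apply, gegenbauerPoly, jacobiIntegral_jacobiPoly_mul _ _ hq,
    smul_zero]

theorem gegenbauerMean_gegenbauerPoly_succ (k : ℕ) :
    gegenbauerMean hn (gegenbauerPoly n (k + 1)) = 0 := by
  have h := gegenbauerMean_gegenbauerPoly_mul hn (k := k + 1) (q := 1)
    (by rw [degree_one]; exact_mod_cast k.succ_pos)
  rwa [mul_one] at h

theorem exists_eq_sum_gegenbauerPoly (k j : ℕ) {q : ℝ[X]} (hq : q.degree < (k + j : ℕ))
    (horth : ∀ r : ℝ[X], r.degree < k → gegenbauerMean hn (q * r) = 0) :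
    ∃ a : ℕ → ℝ, q = ∑ i ∈ Finset.range j, C (a i) * gegenbauerPoly n (k + i) := by
  induction j generalizing q with
  | zero =>
    refine ⟨0, ?_⟩
    by_contra hne
    rw [Finset.range_zero, Finset.sum_empty] at hne
    refine (gegenbauerMean_pos hn (fun t _ => ?_) (mul_self_ne_zero.2 hne)).ne' (horth q hq)
    rw [eval_mul]
    exact mul_self_nonneg _
  | succ j ih =>
    obtain ⟨b, hb⟩ := exists_degree_sub_C_mul_lt hq (gegenbauerPoly_degree hn (k + j))
    obtain ⟨a, ha⟩ := ih hb fun r hr => by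
      rw [sub_mul, map_sub, horth r hr, mul_assoc, linearMap_C_mul,
        gegenbauerMean_gegenbauerPoly_mul hn (hr.trans_le (by norm_cast; lia)), smul_zero,
        sub_zero]
    refine ⟨Function.update a j b, ?_⟩
    rw [Finset.sum_range_succ, Function.update_self, ← sub_eq_iff_eq_add, ha]
    refine Finset.sum_congr rfl fun i hi => ?_
    rw [Function.update_of_ne (Finset.mem_range.1 hi).ne]

/-! ### The adjacent weights -/

/-- The factor `(1 - X) (1 + X) ^ ε` by which the weight of the adjacent polynomials differs
from the Gegenbauer weight. -/
noncomputable def adjacentWeight (ε : ℕ) : ℝ[X] :=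
  (1 - X) * (1 + X) ^ ε

theorem adjacentWeight_eval_pos (ε : ℕ) {t : ℝ} (ht : t ∈ Ioo (-1 : ℝ) 1) :
    0 < (adjacentWeight ε).eval t := by
  have h₁ : 0 < 1 - t := by linarith [ht.2]
  have h₂ : 0 < 1 + t := by linarith [ht.1]
  simp only [adjacentWeight, eval_mul, eval_sub, eval_add, eval_pow, eval_one, eval_X]
  positivity

theorem adjacentWeight_ne_zero (ε : ℕ) : adjacentWeight ε ≠ 0 := fun h => by
  simpa [h] using adjacentWeight_eval_pos ε (t := 0) (by norm_num)

include hn in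
theorem neg_one_lt_add_half_sub_three {u : ℝ} (hu : 0 ≤ u) : -1 < u + ((n : ℝ) - 3) / 2 :=
  (neg_one_lt_half_sub_three hn).trans_le (le_add_of_nonneg_left hu)

/-- The linear functional `f ↦ ∫ f(t) (1 - t) (1 + t) ^ ε dμ_n(t)`. -/
noncomputable def adjacentMean (ε : ℕ) : ℝ[X] →ₗ[ℝ] ℝ :=
  gegenbauerMean hn ∘ₗ LinearMap.mulRight ℝ (adjacentWeight ε)

theorem adjacentMean_apply (ε : ℕ) (f : ℝ[X]) :
    adjacentMean hn ε f = gegenbauerMean hn (f * adjacentWeight ε) := rfl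

theorem adjacentMean_pos (ε : ℕ) {f : ℝ[X]} (hf : ∀ t ∈ Ioo (-1 : ℝ) 1, 0 ≤ f.eval t)
    (h0 : f ≠ 0) : 0 < adjacentMean hn ε f := by
  rw [adjacentMean_apply]
  refine gegenbauerMean_pos hn (fun t ht => ?_) (mul_ne_zero h0 (adjacentWeight_ne_zero ε))
  rw [eval_mul]
  exact mul_nonneg (hf t ht) (adjacentWeight_eval_pos ε ht).le

/-- The adjacent polynomials as a sequence of polynomials of degrees `0, 1, 2, …`. -/
noncomputable def adjacentSequence (ε : ℕ) : Polynomial.Sequence ℝ where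
  elems' := adjacentPoly n ε
  degree_eq' := jacobiPoly_degree (neg_one_lt_add_half_sub_three hn zero_le_one)
    (neg_one_lt_add_half_sub_three hn ε.cast_nonneg)

theorem adjacentMean_adjacentPoly_mul {ε i : ℕ} {q : ℝ[X]} (hq : q.degree < i) :
    adjacentMean hn ε (adjacentPoly n ε i * q) = 0 := by
  have h := jacobiIntegral_mul_pow (neg_one_lt_half_sub_three hn) (neg_one_lt_half_sub_three hn)
    (neg_one_lt_add_half_sub_three hn zero_le_one)
    (neg_one_lt_add_half_sub_three hn ε.cast_nonneg) 1 ε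
    (by rw [Nat.cast_one, add_comm]) (add_comm _ _) (adjacentPoly n ε i * q)
  rw [adjacentPoly, jacobiIntegral_jacobiPoly_mul _ _ hq, pow_one] at h
  rw [adjacentMean_apply, gegenbauerMean, LinearMap.smul_apply, adjacentPoly, adjacentWeight, h,
    smul_zero]

theorem adjacentMean_adjacentPoly_sq_pos (ε i : ℕ) :
    0 < adjacentMean hn ε (adjacentPoly n ε i ^ 2) :=
  adjacentMean_pos hn ε (fun t _ => by rw [eval_pow]; exact sq_nonneg _)
    (pow_ne_zero 2 ((adjacentSequence hn ε).ne_zero i))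

theorem levenshteinKernel_eq (k ε : ℕ) (s : ℝ) :
    levenshteinKernel n k ε s = ∑ i ∈ Finset.range k,
      C ((adjacentPoly n ε i).eval s / adjacentMean hn ε (adjacentPoly n ε i ^ 2)) *
        adjacentPoly n ε i := by
  simp only [adjacentMean_apply, gegenbauerMean_apply, gegenbauerCoeffZero, adjacentWeight,
    levenshteinKernel, eval_mul, eval_pow, eval_sub, eval_add, eval_one, eval_X, mul_assoc]

include hn in
theorem levenshteinKernel_degree_lt (k ε : ℕ) (s : ℝ) :
    (levenshteinKernel n k ε s).degree < k := by
  rw [levenshteinKernel, ← mem_degreeLT]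
  refine Submodule.sum_mem _ fun i hi => mem_degreeLT.2 (degree_C_mul_lt _ ?_)
  rw [show (adjacentPoly n ε i).degree = i from (adjacentSequence hn ε).degree_eq i]
  exact_mod_cast Finset.mem_range.1 hi

theorem adjacentMean_levenshteinKernel_mul {k ε : ℕ} (s : ℝ) {q : ℝ[X]} (hq : q.degree < k) :
    adjacentMean hn ε (levenshteinKernel n k ε s * q) = q.eval s := by
  rw [levenshteinKernel_eq hn]
  exact linearMap_kernel_mul (adjacentSequence hn ε) (adjacentMean hn ε)
    (fun _ _ => adjacentMean_adjacentPoly_mul hn)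
    (fun i => (adjacentMean_adjacentPoly_sq_pos hn ε i).ne') s hq

end Gegenbauer

/-! ### The kernel at one and the two bounds -/

section Bounds

variable {n : ℕ} (hn : 2 ≤ n)

/-- The kernel `∑_{i ≤ k} r_i P_i^{(n)}`, which represents evaluation at `1` on the polynomials
of degree at most `k`. -/
noncomputable def gegenbauerKernelOne (n : ℕ) : ℕ → ℝ[X]
  | 0 => 1
  | k + 1 => gegenbauerKernelOne n k +
      C (((k + 1 + (n - 2)).choose (n - 2) : ℝ) + (k + (n - 2)).choose (n - 2)) *
        gegenbauerPoly n (k + 1)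

theorem cast_succ_mul_choose_add (k v : ℕ) :
    ((k : ℝ) + 1) * (k + 1 + v).choose v = (k + 1 + v) * (k + v).choose v := by
  have h := Nat.choose_mul_succ_eq (k + v) v
  rw [show k + v + 1 - v = k + 1 by lia, show k + v + 1 = k + 1 + v by lia] at h
  exact_mod_cast by rw [mul_comm, ← h, mul_comm]

include hn in
theorem one_sub_X_mul_gegenbauerKernelOne (k : ℕ) :
    (1 - X) * gegenbauerKernelOne n k =
      C ((k + (n - 2)).choose (n - 2) : ℝ) * (gegenbauerPoly n k - gegenbauerPoly n (k + 1)) := by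
  induction k with
  | zero => simp [gegenbauerKernelOne, gegenbauerPoly_zero, gegenbauerPoly_one hn]
  | succ k ih =>
    obtain ⟨v, rfl⟩ := Nat.exists_eq_add_of_le' hn
    have hchoose := congrArg (C : ℝ → ℝ[X]) (cast_succ_mul_choose_add k v)
    have hrec := gegenbauerPoly_recurrence hn k
    have hk : C ((k : ℝ) + 1) ≠ 0 := C_ne_zero.2 (by positivity)
    rw [gegenbauerKernelOne, mul_add, ih]
    refine mul_left_cancel₀ hk ?_
    simp only [Nat.add_sub_cancel, Nat.cast_add, Nat.cast_ofNat, C_add, C_sub, C_mul, C_1,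
      C_ofNat, map_natCast] at hchoose hrec ⊢
    linear_combination
      (gegenbauerPoly (v + 2) (k + 2) - X * gegenbauerPoly (v + 2) (k + 1)) * hchoose +
        ((k + v).choose v : ℝ[X]) * hrec

include hn in
theorem one_sub_mul_gegenbauerKernelOne_eval (k : ℕ) (s : ℝ) :
    (1 - s) * (gegenbauerKernelOne n k).eval s = (k + (n - 2)).choose (n - 2) *
      ((gegenbauerPoly n k).eval s - (gegenbauerPoly n (k + 1)).eval s) := by
  simpa using congrArg (eval s) (one_sub_X_mul_gegenbauerKernelOne hn k)

include hn in
theorem gegenbauerKernelOne_eval_neg_one (k : ℕ) :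
    (gegenbauerKernelOne n k).eval (-1) = (k + (n - 2)).choose (n - 2) * (-1) ^ k := by
  have h := one_sub_mul_gegenbauerKernelOne_eval hn k (-1)
  rw [gegenbauerPoly_eval_neg_one hn, gegenbauerPoly_eval_neg_one hn, pow_succ] at h
  linarith

include hn in
theorem gegenbauerKernelOne_degree_lt (k : ℕ) :
    (gegenbauerKernelOne n k).degree < (k + 1 : ℕ) := by
  induction k with
  | zero => rw [gegenbauerKernelOne, degree_one]; norm_num
  | succ k ih =>
    refine (degree_add_le _ _).trans_lt (max_lt (ih.trans (by norm_cast; lia)) ?_)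
    exact degree_C_mul_lt _ (by rw [gegenbauerPoly_degree hn]; norm_cast; lia)

theorem gegenbauerMean_gegenbauerKernelOne (k : ℕ) :
    gegenbauerMean hn (gegenbauerKernelOne n k) = 1 := by
  induction k with
  | zero => exact gegenbauerMean_one hn
  | succ k ih =>
    rw [gegenbauerKernelOne, map_add, ih, linearMap_C_mul, gegenbauerMean_gegenbauerPoly_succ,
      smul_zero, add_zero]

theorem gegenbauerMean_gegenbauerKernelOne_mul {k : ℕ} {q : ℝ[X]} (hq : q.degree < (k + 1 : ℕ)) :
    gegenbauerMean hn (gegenbauerKernelOne n k * q) = q.eval 1 := by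
  obtain ⟨r, hqr, hr⟩ := exists_eq_C_add_X_sub_C_mul (1 : ℝ) (add_comm k 1 ▸ hq)
  set c : ℝ := ((k + (n - 2)).choose (n - 2) : ℝ)
  have hsplit : gegenbauerKernelOne n k * q = C (q.eval 1) * gegenbauerKernelOne n k +
      C c * (gegenbauerPoly n (k + 1) * r - gegenbauerPoly n k * r) := by
    have hker := one_sub_X_mul_gegenbauerKernelOne hn k
    conv_lhs => rw [hqr]
    linear_combination (norm := (simp only [C_1]; ring)) -r * hker
  rw [hsplit, map_add, linearMap_C_mul, linearMap_C_mul, map_sub,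
    gegenbauerMean_gegenbauerKernelOne, gegenbauerMean_gegenbauerPoly_mul hn hr,
    gegenbauerMean_gegenbauerPoly_mul hn (hr.trans (by norm_cast; lia)), sub_zero, smul_zero,
    add_zero, smul_eq_mul, mul_one]

include hn in
theorem dgsBound_two_mul (k : ℕ) : (dgsBound n (2 * k) : ℝ) = (gegenbauerKernelOne n k).eval 1 := by
  obtain ⟨v, rfl⟩ := Nat.exists_eq_add_of_le' hn
  have hdgs (k : ℕ) : dgsBound (v + 2) (2 * k) =
      (k + v + 1).choose (v + 1) + (k + v).choose (v + 1) := by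
    rw [dgsBound]; congr 2 <;> lia
  rw [hdgs]
  induction k with
  | zero => simp [gegenbauerKernelOne]
  | succ k ih =>
    rw [gegenbauerKernelOne, eval_add, ← ih, eval_mul, eval_C, gegenbauerPoly_eval_one,
      Nat.add_sub_cancel, Nat.choose_succ_succ' (k + 1 + v), add_right_comm k 1 v,
      Nat.choose_succ_succ' (k + v)]
    push_cast
    ring

include hn in
theorem dgsBound_two_mul_add_one (k : ℕ) : (dgsBound n (2 * k + 1) : ℝ) =
    (gegenbauerKernelOne n k).eval 1 + (k + (n - 2)).choose (n - 2) := by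
  rw [← dgsBound_two_mul hn]
  obtain ⟨v, rfl⟩ := Nat.exists_eq_add_of_le' hn
  have hodd : dgsBound (v + 2) (2 * k + 1) = 2 * (k + v + 1).choose (v + 1) := by
    have hdiv : (2 * k + 1 + 1) / 2 = k + 1 := by lia
    have hmod : (2 * k + 1 + 1) % 2 = 0 := by lia
    rw [dgsBound, hdiv, hmod, two_mul]
    congr 2 <;> lia
  have heven : dgsBound (v + 2) (2 * k) =
      (k + v + 1).choose (v + 1) + (k + v).choose (v + 1) := by
    rw [dgsBound]; congr 2 <;> lia
  rw [hodd, heven, Nat.add_sub_cancel, Nat.choose_succ_succ' (k + v)]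
  push_cast
  ring

include hn in
theorem gegenbauerKernelOne_eval_one (k : ℕ) : (gegenbauerKernelOne n k).eval 1 =
    (k + (n - 2)).choose (n - 2) * ((2 * (k : ℝ) + n - 1) / ((n : ℝ) - 1)) := by
  obtain ⟨v, rfl⟩ := Nat.exists_eq_add_of_le' hn
  have hv : ((v + 2 : ℕ) : ℝ) - 1 = v + 1 := by push_cast; ring
  rw [Nat.add_sub_cancel, add_sub_assoc, hv]
  have hv0 : (v : ℝ) + 1 ≠ 0 := by positivity
  induction k with
  | zero => simp [gegenbauerKernelOne, hv0]
  | succ k ih =>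
    have hchoose := cast_succ_mul_choose_add k v
    rw [gegenbauerKernelOne, eval_add, ih, eval_mul, eval_C, gegenbauerPoly_eval_one,
      Nat.add_sub_cancel]
    push_cast
    field_simp
    linear_combination -2 * hchoose

include hn in
theorem levenshteinBound_eq (k ε : ℕ) {s : ℝ} (hs : s < 1) :
    levenshteinBound n (k + 1) ε s = (gegenbauerKernelOne n (k + ε)).eval 1 -
      (1 + s) ^ ε * (gegenbauerKernelOne n (k + ε)).eval s /
        (ε * (gegenbauerPoly n (k + 1)).eval s + (gegenbauerPoly n (k + ε + 1)).eval s) := by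
  have hs' : 1 - s ≠ 0 := (sub_pos.2 hs).ne'
  have hker : (gegenbauerKernelOne n (k + ε)).eval s = (k + ε + (n - 2)).choose (n - 2) *
      ((gegenbauerPoly n (k + ε)).eval s - (gegenbauerPoly n (k + ε + 1)).eval s) / (1 - s) := by
    rw [eq_div_iff hs', ← one_sub_mul_gegenbauerKernelOne_eval hn, mul_comm]
  rw [levenshteinBound, show k + 1 + n - 3 + ε = k + ε + (n - 2) by lia, Nat.add_sub_cancel,
    show k + 1 + ε = k + ε + 1 by lia, hker, gegenbauerKernelOne_eval_one hn]
  push_cast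
  generalize (ε : ℝ) * (gegenbauerPoly n (k + 1)).eval s + _ = E
  generalize 1 - s = d
  ring

include hn in
theorem levenshteinBound_zero (k : ℕ) {s : ℝ} (hs : s < 1) :
    levenshteinBound n (k + 1) 0 s = (gegenbauerKernelOne n k).eval 1 -
      (gegenbauerKernelOne n k).eval s / (gegenbauerPoly n (k + 1)).eval s := by
  simpa using levenshteinBound_eq hn k 0 hs

include hn in
theorem levenshteinBound_one (k : ℕ) {s : ℝ} (hs : s < 1) :
    levenshteinBound n (k + 1) 1 s = (gegenbauerKernelOne n (k + 1)).eval 1 -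
      (1 + s) * (gegenbauerKernelOne n (k + 1)).eval s /
        ((gegenbauerPoly n (k + 1)).eval s + (gegenbauerPoly n (k + 2)).eval s) := by
  simpa using levenshteinBound_eq hn k 1 hs

include hn in
theorem levenshteinBound_zero_le_of_eval_eq {k : ℕ} {s : ℝ} (hs : s < 1)
    (h : (gegenbauerPoly n k).eval s = (gegenbauerPoly n (k + 2)).eval s) :
    levenshteinBound n (k + 1) 0 s ≤ dgsBound n (2 * k + 1) := by
  have hpos : (0 : ℝ) < 2 * k + n := by positivity
  have hrec := congrArg (eval s) (gegenbauerPoly_recurrence hn k)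
  simp only [eval_sub, eval_mul, eval_C, eval_X, ← h] at hrec
  have hP : (gegenbauerPoly n k).eval s = s * (gegenbauerPoly n (k + 1)).eval s :=
    mul_left_cancel₀ hpos.ne' (by linear_combination hrec)
  have hK : (gegenbauerKernelOne n k).eval s =
      -((k + (n - 2)).choose (n - 2) * (gegenbauerPoly n (k + 1)).eval s) := by
    refine mul_left_cancel₀ (sub_pos.2 hs).ne' ?_
    rw [one_sub_mul_gegenbauerKernelOne_eval hn, hP]
    ring
  rw [levenshteinBound_zero hn k hs, dgsBound_two_mul_add_one hn, hK]
  rcases eq_or_ne ((gegenbauerPoly n (k + 1)).eval s) 0 with h0 | h0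
  · simp [h0]
  · rw [neg_div, mul_div_cancel_right₀ _ h0, sub_neg_eq_add]

include hn in
theorem levenshteinBound_one_le_of_eval_eq {k : ℕ} {s : ℝ} (hs : s < 1)
    (h : (gegenbauerPoly n (k + 1)).eval s = (gegenbauerPoly n (k + 2)).eval s) :
    levenshteinBound n (k + 1) 1 s ≤ dgsBound n (2 * k + 2) := by
  have hK : (gegenbauerKernelOne n (k + 1)).eval s = 0 := by
    refine mul_left_cancel₀ (sub_pos.2 hs).ne' ?_
    rw [one_sub_mul_gegenbauerKernelOne_eval hn, h, sub_self, mul_zero, mul_zero]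
  rw [levenshteinBound_one hn k hs, hK, mul_zero, zero_div, sub_zero]
  exact (dgsBound_two_mul hn (k + 1)).ge

/-! ### Quasi-orthogonal polynomials -/

theorem exists_eq_C_mul_sub_of_orthogonal {k : ℕ} {q : ℝ[X]} (hq : q.degree < (k + 2 : ℕ))
    (horth : ∀ r : ℝ[X], r.degree < k → gegenbauerMean hn (q * r) = 0) (h1 : q.eval 1 = 0) :
    ∃ a : ℝ, q = C a * (gegenbauerPoly n k - gegenbauerPoly n (k + 1)) := by
  obtain ⟨a, rfl⟩ := exists_eq_sum_gegenbauerPoly hn k 2 hq horth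
  simp only [Finset.sum_range_succ, Finset.sum_range_zero, zero_add, add_zero, eval_add, eval_mul,
    eval_C, gegenbauerPoly_eval_one] at h1 ⊢
  refine ⟨a 0, ?_⟩
  rw [show a 1 = -a 0 by linarith, C_neg]
  ring

theorem exists_eq_C_mul_sub_add_two_of_orthogonal {k : ℕ} {q : ℝ[X]} (hq : q.degree < (k + 3 : ℕ))
    (horth : ∀ r : ℝ[X], r.degree < k → gegenbauerMean hn (q * r) = 0) (h1 : q.eval 1 = 0)
    (hneg : q.eval (-1) = 0) :
    ∃ a : ℝ, q = C a * (gegenbauerPoly n k - gegenbauerPoly n (k + 2)) := by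
  obtain ⟨a, rfl⟩ := exists_eq_sum_gegenbauerPoly hn k 3 hq horth
  simp only [Finset.sum_range_succ, Finset.sum_range_zero, zero_add, add_zero, eval_add, eval_mul,
    eval_C, gegenbauerPoly_eval_one, gegenbauerPoly_eval_neg_one hn] at h1 hneg ⊢
  have hneg' : a 0 - a 1 + a 2 = 0 :=
    mul_right_cancel₀ (pow_ne_zero k (by norm_num : (-1 : ℝ) ≠ 0))
      (by linear_combination hneg)
  refine ⟨a 0, ?_⟩
  rw [show a 1 = 0 by linarith, show a 2 = -a 0 by linarith, C_neg, C_0]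
  ring

theorem exists_eq_gegenbauerKernelOne_add {k m j : ℕ} (hkm : k ≤ m) (hmj : m ≤ k + j) {F : ℝ[X]}
    (hF : F.degree < (k + 1 + j : ℕ))
    (hrep : ∀ q : ℝ[X], q.degree < (k + 1 : ℕ) →
      gegenbauerMean hn (F * q) = gegenbauerMean hn F * q.eval 1) :
    ∃ a : ℕ → ℝ, F = C (gegenbauerMean hn F) * gegenbauerKernelOne n m +
      ∑ i ∈ Finset.range j, C (a i) * gegenbauerPoly n (k + 1 + i) := by
  have hK : (C (gegenbauerMean hn F) * gegenbauerKernelOne n m).degree < (k + 1 + j : ℕ) :=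
    (degree_C_mul_lt _ (gegenbauerKernelOne_degree_lt hn m)).trans_le (by norm_cast; lia)
  obtain ⟨a, ha⟩ := exists_eq_sum_gegenbauerPoly hn (k + 1) j
    ((degree_sub_le _ _).trans_lt (max_lt hF hK)) fun q hq => by
      rw [sub_mul, map_sub, hrep q hq, mul_assoc, linearMap_C_mul,
        gegenbauerMean_gegenbauerKernelOne_mul hn (hq.trans_le (by norm_cast; lia)), smul_eq_mul,
        sub_self]
  exact ⟨a, by rw [← ha, add_sub_cancel]⟩

theorem gegenbauerMean_mul_levenshteinBound_zero {k : ℕ} {s : ℝ} (hs : s < 1)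
    (hden : (gegenbauerPoly n (k + 1)).eval s ≠ 0) {F : ℝ[X]} (hF : F.degree < (k + 2 : ℕ))
    (hrep : ∀ q : ℝ[X], q.degree < (k + 1 : ℕ) →
      gegenbauerMean hn (F * q) = gegenbauerMean hn F * q.eval 1)
    (hFs : F.eval s = 0) :
    gegenbauerMean hn F * levenshteinBound n (k + 1) 0 s = F.eval 1 := by
  obtain ⟨a, ha⟩ := exists_eq_gegenbauerKernelOne_add hn le_rfl (Nat.le_add_right k 1) hF hrep
  rw [Finset.sum_range_one, add_zero] at ha
  have hone := congrArg (eval 1) ha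
  have hat := congrArg (eval s) ha
  simp only [eval_add, eval_mul, eval_C, gegenbauerPoly_eval_one, hFs] at hone hat
  rw [levenshteinBound_zero hn k hs, hone]
  field_simp
  linear_combination hat

theorem gegenbauerMean_mul_levenshteinBound_one {k : ℕ} {s : ℝ} (hs : s < 1)
    (hden : (gegenbauerPoly n (k + 1)).eval s + (gegenbauerPoly n (k + 2)).eval s ≠ 0) {F : ℝ[X]}
    (hF : F.degree < (k + 3 : ℕ))
    (hrep : ∀ q : ℝ[X], q.degree < (k + 1 : ℕ) →
      gegenbauerMean hn (F * q) = gegenbauerMean hn F * q.eval 1)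
    (hFs : F.eval s = 0) (hFneg : F.eval (-1) = 0) :
    gegenbauerMean hn F * levenshteinBound n (k + 1) 1 s = F.eval 1 := by
  obtain ⟨a, ha⟩ := exists_eq_gegenbauerKernelOne_add hn (Nat.le_add_right k 1)
    (j := 2) (by lia) hF hrep
  set c : ℝ := ((k + 1 + (n - 2)).choose (n - 2) : ℝ)
  have hone := congrArg (eval 1) ha
  have hat := congrArg (eval s) ha
  have hneg := congrArg (eval (-1)) ha
  simp only [Finset.sum_range_succ, Finset.sum_range_zero, zero_add, add_zero, eval_add, eval_mul,
    eval_C, gegenbauerPoly_eval_one, hFs, hFneg, gegenbauerKernelOne_eval_neg_one hn,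
    gegenbauerPoly_eval_neg_one hn] at hone hat hneg
  have ha1 : a 1 = gegenbauerMean hn F * c + a 0 :=
    mul_right_cancel₀ (pow_ne_zero (k + 1) (by norm_num : (-1 : ℝ) ≠ 0))
      (by linear_combination hneg)
  have hker := one_sub_mul_gegenbauerKernelOne_eval hn (k + 1) s
  rw [ha1] at hone hat
  rw [levenshteinBound_one hn k hs, hone]
  field_simp
  linear_combination 2 * hat + gegenbauerMean hn F * hker

end Bounds

/-! ### The Levenshtein quadrature at the nodal polynomial -/

section Nodal

variable {n : ℕ} (hn : 2 ≤ n)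

include hn in
theorem levenshteinBound_zero_denom_ne_zero {k : ℕ} {s : ℝ} (hs : s < 1)
    (hlow : dgsBound n (2 * k + 1) < levenshteinBound n (k + 1) 0 s) :
    (gegenbauerPoly n (k + 1)).eval s ≠ 0 := by
  intro h
  rw [levenshteinBound_zero hn k hs, h, div_zero, sub_zero, dgsBound_two_mul_add_one hn] at hlow
  exact hlow.not_ge (le_add_of_nonneg_right (Nat.cast_nonneg _))

include hn in
theorem levenshteinBound_one_denom_ne_zero {k : ℕ} {s : ℝ} (hs : s < 1)
    (hlow : dgsBound n (2 * k + 2) < levenshteinBound n (k + 1) 1 s) :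
    (gegenbauerPoly n (k + 1)).eval s + (gegenbauerPoly n (k + 2)).eval s ≠ 0 := by
  intro h
  rw [levenshteinBound_one hn k hs, h, div_zero, sub_zero] at hlow
  exact hlow.ne (dgsBound_two_mul hn (k + 1))

theorem levenshteinBound_le_of_orthogonal {k ε : ℕ} {s : ℝ} (hε : ε ≤ 1) (hs : s < 1) {q : ℝ[X]}
    (hq0 : q ≠ 0) (hq : q.degree < (k + ε : ℕ))
    (horth : ∀ r : ℝ[X], r.degree < (k + ε : ℕ) →
      gegenbauerMean hn ((C s - X) * (1 - X) * (1 + X) ^ (1 - ε) * (q * r)) = 0) :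
    levenshteinBound n (k + 1) ε s ≤ dgsBound n (2 * k + 1 + ε) := by
  have hX (a : ℝ) : (C a - X).degree = 1 := by rw [← neg_sub, degree_neg, degree_X_sub_C]
  have hdeg : ((C s - X) * (1 - X) * (1 + X) ^ (1 - ε)).degree = ((3 - ε : ℕ) : WithBot ℕ) := by
    rw [add_comm 1 X, ← C_1, degree_mul, degree_mul, hX, hX, degree_pow, degree_X_add_C, nsmul_one]
    norm_cast
    lia
  set W := (C s - X) * (1 - X) * (1 + X) ^ (1 - ε) with hW
  have hWq : W * q ≠ 0 := mul_ne_zero (ne_zero_of_coe_le_degree hdeg.ge) hq0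
  have hWqd : (W * q).degree < (3 - ε + (k + ε) : ℕ) := (degree_mul_lt_iff hdeg).2 hq
  have horth' (r : ℝ[X]) (hr : r.degree < (k + ε : ℕ)) : gegenbauerMean hn (W * q * r) = 0 := by
    rw [mul_assoc]
    exact horth r hr
  have hs0 : (W * q).eval s = 0 := by simp [hW]
  have hone : (W * q).eval 1 = 0 := by simp [hW]
  obtain rfl | rfl : ε = 0 ∨ ε = 1 := by lia
  · obtain ⟨a, ha⟩ := exists_eq_C_mul_sub_add_two_of_orthogonal hn
      (hWqd.trans_le (by norm_cast; lia)) horth' hone (by simp [hW])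
    have ha0 : a ≠ 0 := by
      rintro rfl
      exact hWq (by rw [ha, C_0, zero_mul])
    refine levenshteinBound_zero_le_of_eval_eq hn hs (sub_eq_zero.1 ?_)
    simpa [ha, ha0] using hs0
  · obtain ⟨a, ha⟩ := exists_eq_C_mul_sub_of_orthogonal hn (hWqd.trans_le (by norm_cast; lia))
      horth' hone
    have ha0 : a ≠ 0 := by
      rintro rfl
      exact hWq (by rw [ha, C_0, zero_mul])
    refine levenshteinBound_one_le_of_eval_eq hn hs (sub_eq_zero.1 ?_)
    simpa [ha, ha0] using hs0

/-- The Levenshtein polynomial with the double zeros made simple: up to a constant factor, the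
nodal polynomial of the Levenshtein quadrature. -/
noncomputable def levenshteinNodal (n k ε : ℕ) (s : ℝ) : ℝ[X] :=
  (X - C s) * (X + 1) ^ ε * levenshteinKernel n k ε s

include hn in
theorem levenshteinNodal_degree_lt (k ε : ℕ) (s : ℝ) :
    (levenshteinNodal n k ε s).degree < (1 + ε + k : ℕ) := by
  have hd : ((X - C s) * (X + 1) ^ ε).degree = ((1 + ε : ℕ) : WithBot ℕ) := by
    rw [← C_1, degree_mul, degree_pow, degree_X_sub_C, degree_X_add_C, nsmul_one]; norm_cast
  rw [levenshteinNodal, degree_mul_lt_iff hd]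
  exact levenshteinKernel_degree_lt hn k ε s

theorem gegenbauerMean_levenshteinNodal_mul {k : ℕ} (ε : ℕ) (s : ℝ) {q : ℝ[X]}
    (hq : q.degree < (1 + k : ℕ)) :
    gegenbauerMean hn (levenshteinNodal n (k + 1) ε s * q) =
      gegenbauerMean hn (levenshteinNodal n (k + 1) ε s) * q.eval 1 := by
  obtain ⟨r, hqr, hr⟩ := exists_eq_C_add_X_sub_C_mul (1 : ℝ) hq
  have hker := adjacentMean_levenshteinKernel_mul hn (k := k + 1) (ε := ε) s
    (q := (X - C s) * r) (by rwa [add_comm, degree_mul_lt_iff (d := 1) (degree_X_sub_C s)])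
  rw [eval_mul, eval_sub, eval_X, eval_C, sub_self, zero_mul, adjacentMean_apply] at hker
  have hsplit : levenshteinNodal n (k + 1) ε s * q =
      C (q.eval 1) * levenshteinNodal n (k + 1) ε s -
        levenshteinKernel n (k + 1) ε s * ((X - C s) * r) * adjacentWeight ε := by
    conv_lhs => rw [hqr]
    rw [levenshteinNodal, adjacentWeight, C_1, add_comm X 1]
    ring
  rw [hsplit, map_sub, hker, sub_zero, linearMap_C_mul, smul_eq_mul, mul_comm]

theorem gegenbauerMean_levenshteinNodal_mul_levenshteinBound {k ε : ℕ} {s : ℝ} (hε : ε ≤ 1)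
    (hs : s < 1) (hlow : dgsBound n (2 * k + 1 + ε) < levenshteinBound n (k + 1) ε s) :
    gegenbauerMean hn (levenshteinNodal n (k + 1) ε s) * levenshteinBound n (k + 1) ε s =
      (levenshteinNodal n (k + 1) ε s).eval 1 := by
  have hdeg := levenshteinNodal_degree_lt hn (k + 1) ε s
  have hrep (q : ℝ[X]) (hq : q.degree < (k + 1 : ℕ)) :=
    gegenbauerMean_levenshteinNodal_mul hn (k := k) ε s (add_comm k 1 ▸ hq)
  have hzero : (levenshteinNodal n (k + 1) ε s).eval s = 0 := by simp [levenshteinNodal]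
  obtain rfl | rfl : ε = 0 ∨ ε = 1 := by lia
  · exact gegenbauerMean_mul_levenshteinBound_zero hn hs
      (levenshteinBound_zero_denom_ne_zero hn hs hlow) (hdeg.trans_le (by norm_cast; lia)) hrep
      hzero
  · exact gegenbauerMean_mul_levenshteinBound_one hn hs
      (levenshteinBound_one_denom_ne_zero hn hs hlow) (hdeg.trans_le (by norm_cast; lia)) hrep hzero
      (by simp [levenshteinNodal])

theorem gegenbauerMean_levenshteinNodal_mul_eq {k ε : ℕ} {s : ℝ} (hε : ε ≤ 1) (hs : s < 1)
    (hlow : dgsBound n (2 * k + 1 + ε) < levenshteinBound n (k + 1) ε s) {q : ℝ[X]}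
    (hq : q.degree < (1 + k : ℕ)) :
    gegenbauerMean hn (levenshteinNodal n (k + 1) ε s * q) =
      (levenshteinNodal n (k + 1) ε s * q).eval 1 / levenshteinBound n (k + 1) ε s := by
  have hbound : levenshteinBound n (k + 1) ε s ≠ 0 := ((Nat.cast_nonneg _).trans_lt hlow).ne'
  rw [gegenbauerMean_levenshteinNodal_mul hn ε s hq, eval_mul, eq_div_iff hbound,
    ← gegenbauerMean_levenshteinNodal_mul_levenshteinBound hn hε hs hlow]
  ring

end Nodal

/-! ### Zeros of orthogonal polynomials -/

section Orthogonal

theorem degree_mul_sq_lt {K : Type*} [Field K] {p q : K[X]} {d m N : ℕ} (hp : p.natDegree ≤ d)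
    (hq : q.degree < m) (hN : d + 2 * m ≤ N + 1) : (p * q ^ 2).degree < N := by
  rcases eq_or_ne q 0 with rfl | hq0
  · simp
  have hqm : q.natDegree < m := (natDegree_lt_iff_degree_lt hq0).2 hq
  have hle : (p * q ^ 2).natDegree ≤ d + 2 * q.natDegree :=
    natDegree_mul_le.trans (add_le_add hp natDegree_pow_le)
  exact degree_le_natDegree.trans_lt (by norm_cast; lia)

variable {φ : ℝ[X] →ₗ[ℝ] ℝ} {m : ℕ} {p : ℝ[X]}

theorem linearMap_mul_eq_zero_of_sq_eq_zero (hφ : ∀ q : ℝ[X], q.degree < m → 0 ≤ φ (q ^ 2))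
    (hp : p.degree < m) (h0 : φ (p ^ 2) = 0) {q : ℝ[X]} (hq : q.degree < m) : φ (p * q) = 0 := by
  have hCS := LinearMap.BilinForm.apply_mul_apply_le_of_forall_zero_le
    (((LinearMap.mul ℝ ℝ[X]).compr₂ φ).domRestrict₁₂ (degreeLT ℝ m) (degreeLT ℝ m))
    (fun r => (hφ r (mem_degreeLT.1 r.2)).trans_eq (by rw [sq]; rfl))
    ⟨p, mem_degreeLT.2 hp⟩ ⟨q, mem_degreeLT.2 hq⟩
  simp only [LinearMap.domRestrict₁₂_apply, LinearMap.compr₂_apply, LinearMap.mul_apply',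
    mul_comm q p, ← sq, h0, zero_mul] at hCS
  exact pow_eq_zero_iff two_ne_zero |>.1 (hCS.antisymm (sq_nonneg _))

variable (hpos : ∀ q : ℝ[X], q ≠ 0 → q.degree < m → 0 < φ (q ^ 2)) (hp0 : p ≠ 0)
  (hp : p.degree < (m + 1 : ℕ)) (horth : ∀ q : ℝ[X], q.degree < m → φ (p * q) = 0)

include hpos hp0 hp horth

theorem natDegree_eq_of_orthogonal : p.natDegree = m := by
  refine (Nat.lt_succ_iff.1 ((natDegree_lt_iff_degree_lt hp0).2 hp)).eq_of_not_lt fun hlt => ?_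
  have hpm : p.degree < m := (natDegree_lt_iff_degree_lt hp0).1 hlt
  exact (hpos p hp0 hpm).ne' (by rw [sq, horth p hpm])

theorem not_sq_add_C_sq_dvd_of_orthogonal (a b : ℝ) : ¬ (X - C a) ^ 2 + C (b ^ 2) ∣ p := by
  rintro ⟨r, rfl⟩
  have hr0 : r ≠ 0 := right_ne_zero_of_mul hp0
  have hdeg := natDegree_eq_of_orthogonal hpos hp0 hp horth
  rw [natDegree_mul (left_ne_zero_of_mul hp0) hr0, natDegree_add_C, natDegree_pow,
    natDegree_X_sub_C] at hdeg
  have hX : (X - C a) * r ≠ 0 := mul_ne_zero (X_sub_C_ne_zero a) hr0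
  have hr : r.degree < m := (natDegree_lt_iff_degree_lt hr0).1 (by lia)
  have hXr : ((X - C a) * r).degree < (m : WithBot ℕ) := (natDegree_lt_iff_degree_lt hX).1 (by
    rw [natDegree_mul (X_sub_C_ne_zero a) hr0, natDegree_X_sub_C]; lia)
  have hsplit : ((X - C a) ^ 2 + C (b ^ 2)) * r * r =
      ((X - C a) * r) ^ 2 + C (b ^ 2) * r ^ 2 := by ring
  have h0 := horth r hr
  rw [hsplit, map_add, linearMap_C_mul, smul_eq_mul] at h0
  exact (add_pos_of_pos_of_nonneg (hpos _ hX hXr)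
    (mul_nonneg (sq_nonneg b) (hpos r hr0 hr).le)).ne' h0

theorem splits_of_orthogonal : p.Splits := by
  refine .of_splits_map (algebraMap ℝ ℂ) (IsAlgClosed.splits _) fun z hz => ?_
  rw [mem_roots_map_of_injective (algebraMap ℝ ℂ).injective hp0, ← aeval_def] at hz
  by_contra hre
  have him : z.im ≠ 0 := fun h => hre ⟨z.re, Complex.ext rfl h.symm⟩
  refine not_sq_add_C_sq_dvd_of_orthogonal hpos hp0 hp horth z.re z.im ?_
  have hnorm : ‖z‖ ^ 2 = z.re ^ 2 + z.im ^ 2 := by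
    rw [← Complex.normSq_eq_norm_sq, Complex.normSq_apply]; ring
  convert! quadratic_dvd_of_aeval_eq_zero_im_ne_zero p hz him using 1
  rw [hnorm]
  simp only [C_add, C_mul, C_pow, C_ofNat]
  ring

theorem card_roots_of_orthogonal : Multiset.card p.roots = m := by
  rw [← natDegree_eq_of_orthogonal hpos hp0 hp horth]
  exact splits_iff_card_roots.1 (splits_of_orthogonal hpos hp0 hp horth)

theorem nodup_roots_of_orthogonal : p.roots.Nodup := by
  refine Multiset.nodup_iff_count_le_one.2 fun a => not_lt.1 fun h => ?_
  rw [count_roots] at h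
  refine not_sq_add_C_sq_dvd_of_orthogonal hpos hp0 hp horth a 0 ?_
  simpa using (le_rootMultiplicity_iff hp0).1 (Nat.succ_le_of_lt h)

theorem exists_cofactor_of_mem_roots {α : ℝ} (hα : α ∈ p.roots) :
    ∃ r : ℝ[X], r ≠ 0 ∧ r.degree < m ∧ 0 < φ (r ^ 2) ∧ φ (X * r ^ 2) = α * φ (r ^ 2) := by
  obtain ⟨r, hr⟩ := dvd_iff_isRoot.2 (isRoot_of_mem_roots hα)
  have hr0 : r ≠ 0 := right_ne_zero_of_mul (hr ▸ hp0)
  have hrm : r.degree < m := (degree_mul_lt_iff (d := 1) (degree_X_sub_C α)).1 (by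
    rwa [← hr, add_comm])
  refine ⟨r, hr0, hrm, hpos r hr0 hrm, ?_⟩
  have h0 := horth r hrm
  rw [hr, mul_assoc, sub_mul, map_sub, linearMap_C_mul, ← sq, smul_eq_mul] at h0
  exact sub_eq_zero.1 h0

theorem lt_root_of_orthogonal {a α : ℝ}
    (ha : ∀ q : ℝ[X], q ≠ 0 → q.degree < m → 0 < φ ((X - C a) * q ^ 2)) (hα : α ∈ p.roots) :
    a < α := by
  obtain ⟨r, hr0, hrm, hr, hXr⟩ := exists_cofactor_of_mem_roots hpos hp0 hp horth hα
  have h := ha r hr0 hrm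
  rw [sub_mul, map_sub, hXr, linearMap_C_mul, smul_eq_mul, ← sub_mul] at h
  exact sub_pos.1 (pos_of_mul_pos_left h hr.le)

theorem root_lt_of_orthogonal {b α : ℝ}
    (hb : ∀ q : ℝ[X], q ≠ 0 → q.degree < m → 0 < φ ((C b - X) * q ^ 2)) (hα : α ∈ p.roots) :
    α < b := by
  obtain ⟨r, hr0, hrm, hr, hXr⟩ := exists_cofactor_of_mem_roots hpos hp0 hp horth hα
  have h := hb r hr0 hrm
  rw [sub_mul, map_sub, hXr, linearMap_C_mul, smul_eq_mul, ← sub_mul] at h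
  exact sub_pos.1 (pos_of_mul_pos_left h hr.le)

end Orthogonal

/-! ### The zeros of the Levenshtein polynomial -/

section Levenshtein

variable {n : ℕ} (hn : 2 ≤ n) {k ε : ℕ} {s : ℝ}

/-- The functional `u ↦ ∫ (s - t) (1 - t) u(t) dμ_n(t)` is nonnegative on the polynomials of degree
less than `d` that are nonnegative on `[-1, 1]`. -/
def NonnegBelow (s : ℝ) (d : ℕ) : Prop :=
  ∀ u : ℝ[X], u.degree < d → (∀ t ∈ Icc (-1 : ℝ) 1, 0 ≤ u.eval t) →
    0 ≤ gegenbauerMean hn ((C s - X) * (1 - X) * u)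

/-- The conditions under which the Levenshtein polynomial of degree `2 * k + 1 + ε` has simple
interior zeros: the Levenshtein bound at `s` exceeds the Delsarte-Goethals-Seidel bound, and `s` is
large enough for `NonnegBelow`, as the maximal inner product of a design is. -/
structure LevenshteinAdmissible (k ε : ℕ) (s : ℝ) : Prop where
  le_one : ε ≤ 1
  lt_one : s < 1
  nonnegBelow : NonnegBelow hn s (2 * k + ε)
  dgsBound_lt : dgsBound n (2 * k + 1 + ε) < levenshteinBound n (k + 1) ε s

/-- The functional `f ↦ ∫ f(t) (s - t) (1 - t) (1 + t) ^ ε dμ_n(t)`, for which the Levenshtein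
kernel is an orthogonal polynomial. -/
noncomputable def levenshteinFunctional (ε : ℕ) (s : ℝ) : ℝ[X] →ₗ[ℝ] ℝ :=
  adjacentMean hn ε ∘ₗ LinearMap.mulLeft ℝ (C s - X)

theorem levenshteinFunctional_apply (ε : ℕ) (s : ℝ) (f : ℝ[X]) :
    levenshteinFunctional hn ε s f = gegenbauerMean hn ((C s - X) * f * adjacentWeight ε) := rfl

theorem levenshteinFunctional_levenshteinKernel_mul {q : ℝ[X]} (hq : q.degree < k) :
    levenshteinFunctional hn ε s (levenshteinKernel n (k + 1) ε s * q) = 0 := by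
  have h := adjacentMean_levenshteinKernel_mul hn (k := k + 1) (ε := ε) s
    (q := (C s - X) * q) (by
      rwa [add_comm, ← neg_sub X, neg_mul, degree_neg,
        degree_mul_lt_iff (d := 1) (degree_X_sub_C s)])
  rw [eval_mul, eval_sub, eval_X, eval_C, sub_self, zero_mul, mul_left_comm] at h
  exact h

theorem levenshteinFunctional_sub_X_mul_sq_pos (ε : ℕ) (s : ℝ) {q : ℝ[X]}
    (hq0 : q ≠ 0) :
    0 < levenshteinFunctional hn ε s ((C s - X) * q ^ 2) := by
  have hsq : (C s - X) * ((C s - X) * q ^ 2) = ((X - C s) * q) ^ 2 := by ring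
  rw [levenshteinFunctional, LinearMap.comp_apply, LinearMap.mulLeft_apply, hsq]
  exact adjacentMean_pos hn ε (fun t _ => by rw [eval_pow]; exact sq_nonneg _)
    (pow_ne_zero 2 (mul_ne_zero (X_sub_C_ne_zero s) hq0))

include hn in
theorem levenshteinKernel_ne_zero (k ε : ℕ) (s : ℝ) : levenshteinKernel n (k + 1) ε s ≠ 0 := by
  intro h
  have hone := adjacentMean_levenshteinKernel_mul hn (k := k + 1) (ε := ε) s (q := 1)
    (by rw [degree_one]; exact_mod_cast k.succ_pos)
  rw [h, zero_mul, map_zero, eval_one] at hone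
  exact zero_ne_one hone

namespace LevenshteinAdmissible

variable {hn} (h : LevenshteinAdmissible hn k ε s) {q : ℝ[X]}

include h

theorem gegenbauerMean_mul_sq_nonneg (hq : q.degree < (k + ε : ℕ)) :
    0 ≤ gegenbauerMean hn ((C s - X) * (1 - X) * (1 + X) ^ (1 - ε) * q ^ 2) := by
  have hε := h.le_one
  rw [mul_assoc _ ((1 + X) ^ (1 - ε))]
  refine h.nonnegBelow _ (degree_mul_sq_lt (d := 1 - ε) ?_ hq (by lia)) fun t ht => ?_
  · exact natDegree_pow_le_of_le _ (by compute_degree) |>.trans_eq (mul_one _)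
  · have ht' : 0 ≤ 1 + t := by linarith [ht.1]
    simp only [eval_mul, eval_pow, eval_add, eval_one, eval_X]
    positivity

theorem gegenbauerMean_mul_sq_pos (hq0 : q ≠ 0) (hq : q.degree < (k + ε : ℕ)) :
    0 < gegenbauerMean hn ((C s - X) * (1 - X) * (1 + X) ^ (1 - ε) * q ^ 2) := by
  refine (h.gegenbauerMean_mul_sq_nonneg hq).lt_of_ne fun h0 => h.dgsBound_lt.not_ge ?_
  refine levenshteinBound_le_of_orthogonal hn h.le_one h.lt_one hq0 hq fun r hr => ?_
  exact linearMap_mul_eq_zero_of_sq_eq_zero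
    (φ := gegenbauerMean hn ∘ₗ LinearMap.mulLeft ℝ ((C s - X) * (1 - X) * (1 + X) ^ (1 - ε)))
    (fun q hq => h.gegenbauerMean_mul_sq_nonneg hq) hq h0.symm hr

theorem levenshteinFunctional_one_add_X_mul_sq_pos (hq0 : q ≠ 0) (hq : q.degree < k) :
    0 < levenshteinFunctional hn ε s ((X - C (-1)) * q ^ 2) := by
  have hdeg : ((X - C (-1 : ℝ)) ^ ε).degree = (ε : WithBot ℕ) := by
    rw [degree_pow, degree_X_sub_C, nsmul_one]
  have hpos := h.gegenbauerMean_mul_sq_pos (mul_ne_zero (ne_zero_of_coe_le_degree hdeg.ge) hq0)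
    (by rwa [add_comm k, degree_mul_lt_iff hdeg])
  rw [levenshteinFunctional_apply]
  convert! hpos using 2
  have hpow : (1 + X : ℝ[X]) ^ (1 - ε) * (1 + X) ^ ε = 1 + X := by
    rw [pow_sub_mul_pow _ h.le_one, pow_one]
  rw [adjacentWeight, C_neg, C_1, sub_neg_eq_add, add_comm X 1]
  linear_combination -((C s - X) * (1 - X) * (1 + X) ^ ε * q ^ 2) * hpow

theorem levenshteinFunctional_one_sub_X_mul_sq_nonneg (hq : q.degree < k) :
    0 ≤ levenshteinFunctional hn ε s ((1 - X) * q ^ 2) := by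
  have hdeg : (adjacentWeight ε).natDegree ≤ 1 + ε :=
    natDegree_mul_le_of_le (by compute_degree)
      ((natDegree_pow_le_of_le _ (by compute_degree)).trans_eq (mul_one _))
  have hnonneg := h.nonnegBelow (adjacentWeight ε * q ^ 2)
    (degree_mul_sq_lt hdeg hq (by lia)) fun t ht => by
      have h₁ : 0 ≤ 1 - t := by linarith [ht.2]
      have h₂ : 0 ≤ 1 + t := by linarith [ht.1]
      simp only [adjacentWeight, eval_mul, eval_pow, eval_add, eval_sub, eval_one, eval_X]
      positivity
  rw [levenshteinFunctional_apply]
  convert! hnonneg using 2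
  ring

theorem levenshteinFunctional_sq_pos (hq0 : q ≠ 0) (hq : q.degree < k) :
    0 < levenshteinFunctional hn ε s (q ^ 2) := by
  have hadd : (2 : ℝ) * levenshteinFunctional hn ε s (q ^ 2) =
      levenshteinFunctional hn ε s ((X - C (-1)) * q ^ 2) +
        levenshteinFunctional hn ε s ((1 - X) * q ^ 2) := by
    have hsum : (X - C (-1)) * q ^ 2 + (1 - X) * q ^ 2 = C 2 * q ^ 2 := by
      rw [C_neg, C_1, C_ofNat]
      ring
    rw [← map_add, hsum, linearMap_C_mul, smul_eq_mul]
  linarith [h.levenshteinFunctional_one_add_X_mul_sq_pos hq0 hq,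
    h.levenshteinFunctional_one_sub_X_mul_sq_nonneg hq]

theorem card_roots_levenshteinKernel :
    Multiset.card (levenshteinKernel n (k + 1) ε s).roots = k :=
  card_roots_of_orthogonal (fun _ => h.levenshteinFunctional_sq_pos)
    (levenshteinKernel_ne_zero hn k ε s) (levenshteinKernel_degree_lt hn _ ε s)
    fun _ => levenshteinFunctional_levenshteinKernel_mul hn

theorem nodup_roots_levenshteinKernel : (levenshteinKernel n (k + 1) ε s).roots.Nodup :=
  nodup_roots_of_orthogonal (fun _ => h.levenshteinFunctional_sq_pos)
    (levenshteinKernel_ne_zero hn k ε s) (levenshteinKernel_degree_lt hn _ ε s)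
    fun _ => levenshteinFunctional_levenshteinKernel_mul hn

theorem mem_Ioo_of_mem_roots_levenshteinKernel {α : ℝ}
    (hα : α ∈ (levenshteinKernel n (k + 1) ε s).roots) : α ∈ Ioo (-1) s :=
  ⟨lt_root_of_orthogonal (fun _ => h.levenshteinFunctional_sq_pos)
      (levenshteinKernel_ne_zero hn k ε s) (levenshteinKernel_degree_lt hn _ ε s)
      (fun _ => levenshteinFunctional_levenshteinKernel_mul hn)
      (fun _ => h.levenshteinFunctional_one_add_X_mul_sq_pos) hα,
    root_lt_of_orthogonal (fun _ => h.levenshteinFunctional_sq_pos)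
      (levenshteinKernel_ne_zero hn k ε s) (levenshteinKernel_degree_lt hn _ ε s)
      (fun _ => levenshteinFunctional_levenshteinKernel_mul hn)
      (fun _ hq0 _ => levenshteinFunctional_sub_X_mul_sq_pos hn ε s hq0) hα⟩

end LevenshteinAdmissible
end Levenshtein

section Nodes

variable {n : ℕ} (hn : 2 ≤ n) {k ε : ℕ} {s : ℝ}

include hn in
theorem levenshteinNodal_ne_zero (k ε : ℕ) (s : ℝ) : levenshteinNodal n (k + 1) ε s ≠ 0 :=
  mul_ne_zero (mul_ne_zero (X_sub_C_ne_zero s) (pow_ne_zero ε (C_1 (R := ℝ) ▸ X_add_C_ne_zero 1)))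
    (levenshteinKernel_ne_zero hn k ε s)

include hn in
theorem roots_levenshteinNodal (k ε : ℕ) (s : ℝ) :
    (levenshteinNodal n (k + 1) ε s).roots =
      s ::ₘ (ε • {-1} + (levenshteinKernel n (k + 1) ε s).roots) := by
  have h0 := levenshteinNodal_ne_zero hn k ε s
  rw [levenshteinNodal] at h0 ⊢
  rw [roots_mul h0, roots_mul (left_ne_zero_of_mul h0), roots_X_sub_C, roots_pow, ← C_1,
    roots_X_add_C, add_assoc, Multiset.singleton_add]

include hn in
theorem interpolationNodes_eq (k ε : ℕ) (s : ℝ) :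
    interpolationNodes n (k + 1) ε s =
      (levenshteinNodal n (k + 1) ε s).roots + (levenshteinKernel n (k + 1) ε s).roots := by
  rw [interpolationNodes, levenshteinPoly, sq, ← mul_assoc, ← levenshteinNodal,
    roots_mul (mul_ne_zero (levenshteinNodal_ne_zero hn k ε s)
      (levenshteinKernel_ne_zero hn k ε s))]

namespace LevenshteinAdmissible

variable {hn}

theorem neg_one_lt (h : LevenshteinAdmissible hn k 1 s) : -1 < s := by
  have hpos := h.gegenbauerMean_mul_sq_pos one_ne_zero (by rw [degree_one]; norm_cast; lia)
  contrapose! hpos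
  rw [one_pow, mul_one, Nat.sub_self, pow_zero, mul_one, ← neg_sub X, neg_mul, map_neg, neg_nonpos]
  refine (gegenbauerMean_pos hn (fun t ht => ?_) (mul_ne_zero (X_sub_C_ne_zero s) ?_)).le
  · rw [eval_mul, eval_sub, eval_sub, eval_X, eval_C, eval_one]
    exact mul_nonneg (by linarith [ht.1]) (by linarith [ht.2])
  · rw [← neg_sub, neg_ne_zero]
    exact X_sub_C_ne_zero 1

variable (h : LevenshteinAdmissible hn k ε s)

include h

theorem nodup_roots_levenshteinNodal : (levenshteinNodal n (k + 1) ε s).roots.Nodup := by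
  have hmem {α : ℝ} := h.mem_Ioo_of_mem_roots_levenshteinKernel (α := α)
  have hs : s ∉ (levenshteinKernel n (k + 1) ε s).roots := fun hs => (hmem hs).2.false
  rw [roots_levenshteinNodal hn]
  obtain rfl | rfl : ε = 0 ∨ ε = 1 := by have := h.le_one; lia
  · rw [zero_nsmul, zero_add]
    exact Multiset.nodup_cons.2 ⟨hs, h.nodup_roots_levenshteinKernel⟩
  · rw [one_nsmul, Multiset.singleton_add, Multiset.nodup_cons, Multiset.nodup_cons,
      Multiset.mem_cons, not_or]
    exact ⟨⟨h.neg_one_lt.ne', hs⟩, fun h1 => (hmem h1).1.false, h.nodup_roots_levenshteinKernel⟩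

theorem levenshteinNodes_val :
    (levenshteinNodes n (k + 1) ε s).val = (levenshteinNodal n (k + 1) ε s).roots := by
  have hle : (levenshteinKernel n (k + 1) ε s).roots ≤ (levenshteinNodal n (k + 1) ε s).roots := by
    rw [levenshteinNodal]
    exact roots.le_of_dvd (levenshteinNodal_ne_zero hn k ε s) (dvd_mul_left _ _)
  rw [levenshteinNodes, interpolationNodes_eq hn, Multiset.toFinset_val,
    (Multiset.subset_of_le hle).dedup_add_left, h.nodup_roots_levenshteinNodal.dedup]

theorem mem_levenshteinNodes {α : ℝ} :
    α ∈ levenshteinNodes n (k + 1) ε s ↔ α ∈ (levenshteinNodal n (k + 1) ε s).roots := by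
  rw [← Finset.mem_val, h.levenshteinNodes_val]

theorem mem_Icc_of_mem_levenshteinNodes (hs : -1 ≤ s) {α : ℝ}
    (hα : α ∈ levenshteinNodes n (k + 1) ε s) : α ∈ Icc (-1) s := by
  rw [h.mem_levenshteinNodes, roots_levenshteinNodal hn, Multiset.mem_cons, Multiset.mem_add] at hα
  rcases hα with rfl | hα | hα
  · exact ⟨hs, le_rfl⟩
  · rw [Multiset.mem_singleton.1 (Multiset.mem_of_mem_nsmul hα)]
    exact ⟨le_rfl, hs⟩
  · exact Ioo_subset_Icc_self (h.mem_Ioo_of_mem_roots_levenshteinKernel hα)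

theorem card_levenshteinNodes : (levenshteinNodes n (k + 1) ε s).card = k + 1 + ε := by
  rw [Finset.card, h.levenshteinNodes_val, roots_levenshteinNodal hn, Multiset.card_cons,
    Multiset.card_add, Multiset.card_nsmul, h.card_roots_levenshteinKernel,
    Multiset.card_singleton]
  lia

theorem card_interpolationNodes :
    Multiset.card (interpolationNodes n (k + 1) ε s) = 2 * k + 1 + ε := by
  rw [interpolationNodes_eq hn, Multiset.card_add, ← h.levenshteinNodes_val, Finset.card_val,
    h.card_levenshteinNodes, h.card_roots_levenshteinKernel]
  lia

theorem levenshteinNodal_degree :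
    (levenshteinNodal n (k + 1) ε s).degree = ((levenshteinNodes n (k + 1) ε s).card : ℕ) := by
  have h0 := levenshteinNodal_ne_zero hn k ε s
  have hlt := (natDegree_lt_iff_degree_lt h0).2 (levenshteinNodal_degree_lt hn (k + 1) ε s)
  have hle := card_roots' (levenshteinNodal n (k + 1) ε s)
  rw [← h.levenshteinNodes_val, Finset.card_val] at hle
  rw [degree_eq_iff_natDegree_eq h0]
  have := h.card_levenshteinNodes
  lia

end LevenshteinAdmissible
end Nodes

/-! ### Quadrature -/

section Quadrature

theorem linearMap_eq_sum_basis {K M : Type*} [Field K] [DecidableEq K] [AddCommGroup M] [Module K M]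
    (ψ : K[X] →ₗ[K] M) {S : Finset K} {p : K[X]} {m : ℕ} (hp : p.degree = S.card)
    (hroot : ∀ α ∈ S, p.eval α = 0) (hψ : ∀ q : K[X], q.degree < m → ψ (p * q) = 0) {g : K[X]}
    (hg : g.degree < (S.card + m : ℕ)) :
    ψ g = ∑ α ∈ S, g.eval α • ψ (Lagrange.basis S id α) := by
  have hp0 : p ≠ 0 := ne_zero_of_coe_le_degree hp.ge
  have hdiv : p * (g / p) + g % p = g := EuclideanDomain.div_add_mod g p
  have hmod : (g % p).degree < S.card := hp ▸ degree_mod_lt g hp0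
  have hquot : (g / p).degree < m := by
    rw [← degree_mul_lt_iff hp, eq_sub_of_add_eq hdiv]
    exact (degree_sub_le _ _).trans_lt
      (max_lt hg (hmod.trans_le (by exact_mod_cast Nat.le_add_right _ _)))
  have heval (α : K) (hα : α ∈ S) : (g % p).eval α = g.eval α := by
    rw [← congrArg (eval α) hdiv, eval_add, eval_mul, hroot α hα, zero_mul, zero_add]
  rw [← congrArg ψ hdiv, map_add, hψ _ hquot, zero_add,
    Lagrange.eq_interpolate_of_eval_eq (v := id) (fun α => g.eval α) (injOn_id _) hmod heval,
    Lagrange.interpolate_apply, map_sum]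
  exact Finset.sum_congr rfl fun α _ => linearMap_C_mul ψ _ _

theorem LevenshteinAdmissible.gegenbauerCoeffZero_eq {n : ℕ} {hn : 2 ≤ n} {k ε : ℕ} {s : ℝ}
    (h : LevenshteinAdmissible hn k ε s) {g : ℝ[X]} (hg : g.degree < (2 * k + 1 + ε : ℕ)) :
    gegenbauerCoeffZero n g = g.eval 1 / levenshteinBound n (k + 1) ε s +
      ∑ α ∈ levenshteinNodes n (k + 1) ε s, levenshteinWeight n (k + 1) ε s α * g.eval α := by
  have hquad := linearMap_eq_sum_basis
    (gegenbauerMean hn - (levenshteinBound n (k + 1) ε s)⁻¹ • leval 1) (m := k)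
    h.levenshteinNodal_degree
    (fun α hα => (mem_roots'.1 (h.mem_levenshteinNodes.1 hα)).2) (fun q hq => ?_)
    (by rwa [h.card_levenshteinNodes, show k + 1 + ε + k = 2 * k + 1 + ε by lia])
  · simp only [LinearMap.sub_apply, LinearMap.smul_apply, leval_apply, smul_eq_mul,
      gegenbauerMean_apply] at hquad
    rw [← sub_eq_iff_eq_add', div_eq_inv_mul, hquad]
    refine Finset.sum_congr rfl fun α _ => ?_
    rw [levenshteinWeight, mul_comm, div_eq_inv_mul]
  · rw [LinearMap.sub_apply, LinearMap.smul_apply, leval_apply, smul_eq_mul, sub_eq_zero,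
      gegenbauerMean_levenshteinNodal_mul_eq hn h.le_one h.lt_one h.dgsBound_lt
        (hq.trans (by norm_cast; lia)), div_eq_inv_mul]

end Quadrature

/-! ### Hermite interpolation -/

section HermitePolynomial

variable {K : Type*} [Field K]

theorem rootMultiplicity_prod_X_sub_C [DecidableEq K] (T : Multiset K) (t : K) :
    (T.map fun a => X - C a).prod.rootMultiplicity t = T.count t := by
  rw [← count_roots, roots_multiset_prod_X_sub_C]

theorem degree_prod_X_sub_C (T : Multiset K) :
    (T.map fun a => X - C a).prod.degree = (Multiset.card T : WithBot ℕ) := by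
  rw [degree_eq_natDegree (monic_multisetProd_X_sub_C T).ne_zero,
    natDegree_multiset_prod_X_sub_C_eq_card]

theorem iterate_derivative_natDegree_of_monic {p : K[X]} (hp : p.Monic) :
    derivative^[p.natDegree] p = C (p.natDegree.factorial : K) := by
  have hdeg := natDegree_iterate_derivative p p.natDegree
  rw [Nat.sub_self, Nat.le_zero] at hdeg
  rw [eq_C_of_natDegree_eq_zero hdeg, coeff_iterate_derivative, zero_add,
    Nat.descFactorial_self, coeff_natDegree, hp.leadingCoeff, nsmul_one]

theorem iterate_derivative_card_add_C_mul_prod {T : Multiset K} {g : K[X]}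
    (hg : g.degree < (Multiset.card T : WithBot ℕ)) (b : K) :
    derivative^[Multiset.card T] (g + C b * (T.map fun a => X - C a).prod) =
      C (b * (Multiset.card T).factorial) := by
  have hprod := iterate_derivative_natDegree_of_monic (monic_multisetProd_X_sub_C T)
  rw [natDegree_multiset_prod_X_sub_C_eq_card] at hprod
  rw [iterate_map_add, iterate_derivative_C_mul, iterate_derivative_eq_zero_of_degree_lt hg,
    zero_add, hprod, C_mul]

variable [DecidableEq K]

theorem eval_iterate_derivative_add_C_mul_prod {T : Multiset K} (g : K[X]) (b : K) {t : K} {j : ℕ}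
    (hj : j < T.count t) :
    (derivative^[j] (g + C b * (T.map fun a => X - C a).prod)).eval t =
      (derivative^[j] g).eval t := by
  rw [← rootMultiplicity_prod_X_sub_C] at hj
  rw [iterate_map_add, iterate_derivative_C_mul, eval_add, eval_C_mul,
    (isRoot_iterate_derivative_of_lt_rootMultiplicity hj).eq_zero, mul_zero, add_zero]

variable [CharZero K]

theorem eval_iterate_derivative_count_prod_ne_zero (T : Multiset K) (t : K) :
    (derivative^[T.count t] (T.map fun a => X - C a).prod).eval t ≠ 0 := by
  intro h0
  have hlt := (lt_rootMultiplicity_iff_isRoot_iterate_derivative (n := T.count t) (t := t)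
    (monic_multisetProd_X_sub_C T).ne_zero).2 fun j hj => by
      rcases hj.eq_or_lt with rfl | hlt
      · exact h0
      · rw [← rootMultiplicity_prod_X_sub_C] at hlt
        exact isRoot_iterate_derivative_of_lt_rootMultiplicity hlt
  exact (hlt.trans_eq (rootMultiplicity_prod_X_sub_C T t)).false

theorem exists_eval_iterate_derivative_eq (v : K → ℕ → K) (T : Multiset K) :
    ∃ g : K[X], g.degree < (Multiset.card T : WithBot ℕ) ∧
      ∀ t ∈ T, ∀ j < T.count t, (derivative^[j] g).eval t = v t j := by
  induction T using Multiset.induction_on with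
  | empty => exact ⟨0, by simp, by simp⟩
  | cons a T ih =>
    obtain ⟨g, hdeg, hg⟩ := ih
    set ω : K[X] := (T.map fun a => X - C a).prod
    have hne : (derivative^[T.count a] ω).eval a ≠ 0 :=
      eval_iterate_derivative_count_prod_ne_zero T a
    set b : K := (v a (T.count a) - (derivative^[T.count a] g).eval a) /
      (derivative^[T.count a] ω).eval a with hb
    have hold (t : K) (j : ℕ) (hj : j < T.count t) :
        (derivative^[j] (g + C b * ω)).eval t = v t j := by
      rw [eval_iterate_derivative_add_C_mul_prod g b hj]
      exact hg t (Multiset.count_pos.1 (Nat.zero_lt_of_lt hj)) j hj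
    have hnew : (derivative^[T.count a] (g + C b * ω)).eval a = v a (T.count a) := by
      rw [iterate_map_add, iterate_derivative_C_mul, eval_add, eval_C_mul, hb,
        div_mul_cancel₀ _ hne, add_sub_cancel]
    refine ⟨g + C b * ω, ?_, fun t _ j hj => ?_⟩
    · rw [Multiset.card_cons]
      have hlt : ((Multiset.card T : ℕ) : WithBot ℕ) < (Multiset.card T + 1 : ℕ) := by
        exact_mod_cast Nat.lt_succ_self _
      exact (degree_add_le _ _).trans_lt
        (max_lt (hdeg.trans hlt) (degree_C_mul_lt b ((degree_prod_X_sub_C T).trans_lt hlt)))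
    · by_cases hta : t = a
      · subst hta
        rw [Multiset.count_cons_self, Nat.lt_succ_iff] at hj
        rcases hj.eq_or_lt with rfl | hlt
        · exact hnew
        · exact hold t j hlt
      · exact hold t j (by rwa [Multiset.count_cons_of_ne hta] at hj)

theorem eq_zero_of_eval_iterate_derivative_eq_zero {T : Multiset K} {g : K[X]}
    (hdeg : g.degree < (Multiset.card T : WithBot ℕ))
    (hg : ∀ t ∈ T, ∀ j < T.count t, (derivative^[j] g).eval t = 0) : g = 0 := by
  by_contra h0
  have hle : T ≤ g.roots := Multiset.le_iff_count.2 fun t => by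
    rcases Nat.eq_zero_or_pos (T.count t) with hc | hc
    · exact hc.trans_le (Nat.zero_le _)
    · obtain ⟨j, hj⟩ := Nat.exists_eq_add_of_le' hc
      rw [count_roots, hj, Nat.succ_le_iff, lt_rootMultiplicity_iff_isRoot_iterate_derivative h0]
      exact fun i hi => hg t (Multiset.count_pos.1 hc) i (by lia)
  rw [← natDegree_lt_iff_degree_lt h0] at hdeg
  exact ((Multiset.card_le_card hle).trans (card_roots' g)).not_gt hdeg

end HermitePolynomial

theorem exists_isHermiteInterpolant (h : ℝ → ℝ) (T : Multiset ℝ) :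
    ∃ g : ℝ[X], IsHermiteInterpolant h T g :=
  exists_eval_iterate_derivative_eq (fun t j => iteratedDeriv j h t) T

namespace IsHermiteInterpolant

variable {h : ℝ → ℝ} {T : Multiset ℝ} {g : ℝ[X]}

theorem unique {g' : ℝ[X]} (hg : IsHermiteInterpolant h T g) (hg' : IsHermiteInterpolant h T g') :
    g = g' := by
  refine sub_eq_zero.1 (eq_zero_of_eval_iterate_derivative_eq_zero
    ((degree_sub_le _ _).trans_lt (max_lt hg.1 hg'.1)) fun t ht j hj => ?_)
  rw [iterate_derivative_sub, eval_sub, hg.2 t ht j hj, hg'.2 t ht j hj, sub_self]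

theorem eval_eq (hg : IsHermiteInterpolant h T g) {t : ℝ} (ht : t ∈ T) : g.eval t = h t := by
  have := hg.2 t ht 0 (Multiset.count_pos.2 ht)
  rwa [iteratedDeriv_zero] at this

end IsHermiteInterpolant

section Rolle

variable {f : ℝ → ℝ} {a b : ℝ}

theorem exists_finset_deriv_eq_zero (hf : ContinuousOn f (Ico a b)) {Z D : Finset ℝ}
    (hZ : ∀ z ∈ Z, z ∈ Ico a b ∧ f z = 0) (hDZ : D ⊆ Z)
    (hD : ∀ z ∈ D, z ∈ Ioo a b ∧ deriv f z = 0) :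
    ∃ Z' : Finset ℝ, (∀ z ∈ Z', z ∈ Ioo a b ∧ deriv f z = 0) ∧ Z.card + D.card ≤ Z'.card + 1 := by
  have hrolle : ∀ x ∈ Z, ∀ y ∈ Z, x < y → ∃ c ∈ Ioo x y, deriv f c = 0 := fun x hx y hy hxy =>
    exists_deriv_eq_zero hxy
      (hf.mono fun t ht => ⟨(hZ x hx).1.1.trans ht.1, ht.2.trans_lt (hZ y hy).1.2⟩)
      ((hZ x hx).2.trans (hZ y hy).2.symm)
  choose! ξ hξ hξ0 using hrolle
  set W := ((Z ×ˢ Z).filter fun p => p.1 < p.2).image fun p => ξ p.1 p.2 with hW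
  have hWmem (z : ℝ) (hz : z ∈ W) : z ∈ Ioo a b ∧ deriv f z = 0 := by
    simp only [hW, Finset.mem_image, Finset.mem_filter, Finset.mem_product] at hz
    obtain ⟨⟨x, y⟩, ⟨⟨hx, hy⟩, hxy⟩, rfl⟩ := hz
    have hmem := hξ x hx y hy hxy
    exact ⟨⟨(hZ x hx).1.1.trans_lt hmem.1, hmem.2.trans (hZ y hy).1.2⟩, hξ0 x hx y hy hxy⟩
  have hcard : Z.card ≤ (W \ Z).card + 1 :=
    Finset.card_le_sdiff_of_interleaved fun x hx y hy hxy _ =>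
      ⟨ξ x y, Finset.mem_image.2 ⟨(x, y), by simp [hx, hy, hxy], rfl⟩, hξ x hx y hy hxy⟩
  refine ⟨(W \ Z) ∪ D, fun z hz => ?_, ?_⟩
  · rcases Finset.mem_union.1 hz with hz | hz
    · exact hWmem z (Finset.mem_sdiff.1 hz).1
    · exact hD z hz
  · rw [Finset.card_union_of_disjoint (Finset.disjoint_of_subset_right hDZ Finset.sdiff_disjoint)]
    lia

theorem exists_iteratedDeriv_eq_zero {m : ℕ}
    (hf : ∀ j < m, DifferentiableOn ℝ (iteratedDeriv j f) (Ioo a b)) {Z : Finset ℝ}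
    (hZ : ∀ z ∈ Z, z ∈ Ioo a b ∧ f z = 0) (hcard : m < Z.card) :
    ∃ ξ ∈ Ioo a b, iteratedDeriv m f ξ = 0 := by
  induction m generalizing f Z with
  | zero =>
    obtain ⟨z, hz⟩ := Finset.card_pos.1 hcard
    exact ⟨z, (hZ z hz).1, by rw [iteratedDeriv_zero, (hZ z hz).2]⟩
  | succ m ih =>
    have hne : Z.Nonempty := Finset.card_pos.1 (by lia)
    have hmin := (hZ _ (Z.min'_mem hne)).1.1
    have hcont : ContinuousOn f (Ico (Z.min' hne) b) := by
      have := (hf 0 m.succ_pos).continuousOn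
      rw [iteratedDeriv_zero] at this
      exact this.mono fun t ht => ⟨hmin.trans_le ht.1, ht.2⟩
    obtain ⟨Z', hZ', hcard'⟩ := exists_finset_deriv_eq_zero hcont (Z := Z) (D := ∅)
      (fun z hz => ⟨⟨Z.min'_le z hz, (hZ z hz).1.2⟩, (hZ z hz).2⟩) (Finset.empty_subset _) (by simp)
    rw [Finset.card_empty] at hcard'
    rw [iteratedDeriv_succ']
    refine ih (fun j hj => ?_)
      (fun z hz => ⟨⟨hmin.trans (hZ' z hz).1.1, (hZ' z hz).1.2⟩, (hZ' z hz).2⟩) (by lia)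
    rw [← iteratedDeriv_succ']
    exact hf (j + 1) (by lia)

theorem exists_iteratedDeriv_eq_zero_of_double_zeros (hcont : ContinuousOn f (Ico a b)) {m : ℕ}
    (hf : ∀ j < m + 1, DifferentiableOn ℝ (iteratedDeriv j f) (Ioo a b)) {Z D : Finset ℝ}
    (hZ : ∀ z ∈ Z, z ∈ Ico a b ∧ f z = 0) (hDZ : D ⊆ Z)
    (hD : ∀ z ∈ D, z ∈ Ioo a b ∧ deriv f z = 0) (hcard : m + 1 < Z.card + D.card) :
    ∃ ξ ∈ Ioo a b, iteratedDeriv (m + 1) f ξ = 0 := by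
  obtain ⟨Z', hZ', hcard'⟩ := exists_finset_deriv_eq_zero hcont hZ hDZ hD
  rw [iteratedDeriv_succ']
  refine exists_iteratedDeriv_eq_zero (fun j hj => ?_) hZ' (by lia)
  rw [← iteratedDeriv_succ']
  exact hf (j + 1) (by lia)

end Rolle

section HermiteError

variable {h : ℝ → ℝ} {a b : ℝ} {τ : ℕ}

theorem iteratedDeriv_sub_eval
    (hdiff : ∀ j < τ, DifferentiableOn ℝ (iteratedDeriv j h) (Ioo a b)) (p : ℝ[X]) {j : ℕ}
    (hj : j ≤ τ) {x : ℝ} (hx : x ∈ Ioo a b) :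
    iteratedDeriv j (fun t => h t - p.eval t) x =
      iteratedDeriv j h x - (derivative^[j] p).eval x := by
  induction j generalizing x with
  | zero => simp only [iteratedDeriv_zero, Function.iterate_zero, id]
  | succ j ih =>
    have hev : iteratedDeriv j (fun t => h t - p.eval t) =ᶠ[nhds x]
        fun t => iteratedDeriv j h t - (derivative^[j] p).eval t :=
      Filter.eventually_of_mem (isOpen_Ioo.mem_nhds hx) fun t ht => ih (by lia) ht
    rw [iteratedDeriv_succ, hev.deriv_eq, iteratedDeriv_succ, Function.iterate_succ_apply',
      deriv_fun_sub ((hdiff j (by lia)).differentiableAt (isOpen_Ioo.mem_nhds hx))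
        (Polynomial.differentiableAt _), Polynomial.deriv]

theorem exists_iteratedDeriv_eq_eval (hcont : ContinuousOn h (Ico a b)) {m : ℕ}
    (hdiff : ∀ j < m + 1, DifferentiableOn ℝ (iteratedDeriv j h) (Ioo a b)) {p : ℝ[X]}
    {Z D : Finset ℝ} (hZ : ∀ z ∈ Z, z ∈ Ico a b ∧ p.eval z = h z) (hDZ : D ⊆ Z)
    (hD : ∀ z ∈ D, z ∈ Ioo a b ∧ (derivative p).eval z = deriv h z)
    (hcard : m + 1 < Z.card + D.card) :
    ∃ ξ ∈ Ioo a b, iteratedDeriv (m + 1) h ξ = (derivative^[m + 1] p).eval ξ := by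
  have hderiv (z : ℝ) (hz : z ∈ D) : deriv (fun t => h t - p.eval t) z = 0 := by
    rw [← iteratedDeriv_one, iteratedDeriv_sub_eval hdiff p m.succ_pos (hD z hz).1,
      iteratedDeriv_one, Function.iterate_one, (hD z hz).2, sub_self]
  obtain ⟨ξ, hξ, hξ0⟩ := exists_iteratedDeriv_eq_zero_of_double_zeros
    (f := fun t => h t - p.eval t) (hcont.sub p.continuous.continuousOn)
    (fun j hj => ((hdiff j hj).sub (derivative^[j] p).differentiable.differentiableOn).congr
      fun t ht => iteratedDeriv_sub_eval hdiff p hj.le ht)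
    (fun z hz => ⟨(hZ z hz).1, sub_eq_zero.2 (hZ z hz).2.symm⟩) hDZ
    (fun z hz => ⟨(hD z hz).1, hderiv z hz⟩) hcard
  rw [iteratedDeriv_sub_eval hdiff p le_rfl hξ] at hξ0
  exact ⟨ξ, hξ, sub_eq_zero.1 hξ0⟩

theorem IsHermiteInterpolant.exists_sub_eval_eq (hcont : ContinuousOn h (Ico a b))
    {Z D : Finset ℝ} {m : ℕ} (hcard : Z.card + D.card = m + 1)
    (hdiff : ∀ j < m + 1, DifferentiableOn ℝ (iteratedDeriv j h) (Ioo a b))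
    (hDZ : D ⊆ Z) (hZ : ∀ z ∈ Z, z ∈ Ico a b) (hD : ∀ z ∈ D, z ∈ Ioo a b) {g : ℝ[X]}
    (hg : IsHermiteInterpolant h (Z.val + D.val) g) {x : ℝ} (hx : x ∈ Ico a b) (hxZ : x ∉ Z) :
    ∃ ξ ∈ Ioo a b, h x - g.eval x = iteratedDeriv (m + 1) h ξ / (m + 1).factorial *
      ((Z.val + D.val).map fun t => X - C t).prod.eval x := by
  set T := Z.val + D.val with hT
  set ω : ℝ[X] := (T.map fun t => X - C t).prod
  have hmem {z : ℝ} : z ∈ T ↔ z ∈ Z := by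
    rw [hT, Multiset.mem_add, Finset.mem_val, Finset.mem_val, or_iff_left_of_imp (@hDZ z)]
  have hTcard : Multiset.card T = m + 1 := by
    rw [hT, Multiset.card_add, Finset.card_val, Finset.card_val, hcard]
  have hωx : ω.eval x ≠ 0 := fun h0 => hxZ <| hmem.1 <| by
    rwa [← roots_multiset_prod_X_sub_C T, mem_roots (monic_multisetProd_X_sub_C T).ne_zero]
  obtain ⟨c, hcx⟩ : ∃ c, c * ω.eval x = h x - g.eval x := ⟨_, div_mul_cancel₀ _ hωx⟩
  set p : ℝ[X] := g + C c * ω with hp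
  have heval (z : ℝ) (j : ℕ) (hj : j < T.count z) :
      (derivative^[j] p).eval z = iteratedDeriv j h z := by
    rw [hp, eval_iterate_derivative_add_C_mul_prod g c hj]
    exact hg.2 z (Multiset.count_pos.1 (Nat.zero_lt_of_lt hj)) j hj
  have hpx : p.eval x = h x := by rw [hp, eval_add, eval_C_mul, hcx, add_sub_cancel]
  have hpZ (z : ℝ) (hz : z ∈ Z) : p.eval z = h z :=
    heval z 0 (Multiset.count_pos.2 (hmem.2 hz))
  have hpD (z : ℝ) (hz : z ∈ D) : (derivative p).eval z = deriv h z := by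
    rw [← iteratedDeriv_one]
    refine heval z 1 ?_
    rw [hT, Multiset.count_add]
    exact Nat.add_lt_add_of_lt_of_le (a := 0) (Multiset.count_pos.2 (hDZ hz))
      (Multiset.count_pos.2 hz)
  obtain ⟨ξ, hξ, hξp⟩ := exists_iteratedDeriv_eq_eval hcont hdiff
    (Finset.forall_mem_insert x Z _ |>.2 ⟨⟨hx, hpx⟩, fun z hz => ⟨hZ z hz, hpZ z hz⟩⟩)
    (hDZ.trans (Finset.subset_insert x Z)) (fun z hz => ⟨hD z hz, hpD z hz⟩)
    (by rw [Finset.card_insert_of_notMem hxZ]; lia)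
  refine ⟨ξ, hξ, ?_⟩
  rw [hξp, ← hTcard, hp, iterate_derivative_card_add_C_mul_prod hg.1, eval_C,
    mul_div_cancel_right₀ _ (by exact_mod_cast Nat.factorial_ne_zero _), hcx]

theorem IsHermiteInterpolant.le_eval (hcont : ContinuousOn h (Ico a b)) {Z D : Finset ℝ} {m : ℕ}
    (hcard : Z.card + D.card = m + 1)
    (hdiff : ∀ j < m + 1, DifferentiableOn ℝ (iteratedDeriv j h) (Ioo a b))
    (hnonneg : ∀ t ∈ Ioo a b, 0 ≤ iteratedDeriv (m + 1) h t)
    (hDZ : D ⊆ Z) (hZ : ∀ z ∈ Z, z ∈ Ico a b) (hD : ∀ z ∈ D, z ∈ Ioo a b) {g : ℝ[X]}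
    (hg : IsHermiteInterpolant h (Z.val + D.val) g) {x : ℝ} (hx : x ∈ Ico a b)
    (hω : ((Z.val + D.val).map fun t => X - C t).prod.eval x ≤ 0) : h x ≤ g.eval x := by
  by_cases hxZ : x ∈ Z
  · exact (hg.eval_eq (Multiset.mem_add.2 (Or.inl hxZ))).ge
  · obtain ⟨ξ, hξ, herr⟩ := hg.exists_sub_eval_eq hcont hcard hdiff hDZ hZ hD hx hxZ
    rw [← sub_nonpos, herr]
    exact mul_nonpos_of_nonneg_of_nonpos (div_nonneg (hnonneg ξ hξ) (Nat.cast_nonneg _)) hω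

end HermiteError

/-! ### Designs -/

namespace WeightedCode

variable {n N : ℕ} {c : WeightedCode n N}

/-- The functional averaging a polynomial over the inner products of all pairs of points of a
weighted code, the diagonal included. -/
noncomputable def pairMean (c : WeightedCode n N) : ℝ[X] →ₗ[ℝ] ℝ :=
  ∑ i, ∑ j, (c.weight i * c.weight j) • leval (inner ℝ (c.point i) (c.point j))

theorem pairMean_apply (c : WeightedCode n N) (f : ℝ[X]) : c.pairMean f =
    ∑ i, ∑ j, c.weight i * c.weight j * f.eval (inner ℝ (c.point i) (c.point j)) := by
  simp only [pairMean, LinearMap.sum_apply, LinearMap.smul_apply, leval_apply, smul_eq_mul]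

theorem inner_self (c : WeightedCode n N) (i : Fin N) : inner ℝ (c.point i) (c.point i) = 1 := by
  rw [real_inner_self_eq_norm_sq, c.norm_point, one_pow]

theorem neg_one_le_inner (c : WeightedCode n N) (i j : Fin N) :
    -1 ≤ (inner ℝ (c.point i) (c.point j) : ℝ) := by
  have h := neg_le_of_abs_le (abs_real_inner_le_norm (c.point i) (c.point j))
  rwa [c.norm_point, c.norm_point, one_mul] at h

theorem inner_lt_one (c : WeightedCode n N) {i j : Fin N} (hij : i ≠ j) :
    (inner ℝ (c.point i) (c.point j) : ℝ) < 1 :=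
  (inner_lt_one_iff_real_of_norm_eq_one (c.norm_point i) (c.norm_point j)).2
    (c.point_injective.ne hij)

theorem IsMaxInner.mem_Ico {s : ℝ} (hs : c.IsMaxInner s) : s ∈ Ico (-1) 1 := by
  obtain ⟨⟨i, j, hij, rfl⟩, -⟩ := hs
  exact ⟨c.neg_one_le_inner i j, c.inner_lt_one hij⟩

theorem IsMaxInner.inner_mem_Icc {s : ℝ} (hs : c.IsMaxInner s) {i j : Fin N} (hij : i ≠ j) :
    (inner ℝ (c.point i) (c.point j) : ℝ) ∈ Icc (-1) s :=
  ⟨c.neg_one_le_inner i j, hs.2 ⟨i, j, hij, rfl⟩⟩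

theorem effectiveSize_pos (c : WeightedCode n N) : 0 < c.effectiveSize := by
  have hne : (Finset.univ : Finset (Fin N)).Nonempty :=
    Finset.nonempty_of_sum_ne_zero (c.sum_weight.trans_ne one_ne_zero)
  exact one_div_pos.2 (Finset.sum_pos (fun i _ => pow_pos (c.weight_pos i) 2) hne)

theorem energy_eval (c : WeightedCode n N) (g : ℝ[X]) :
    c.energy (fun t => g.eval t) = c.pairMean g - g.eval 1 / c.effectiveSize := by
  rw [energy, pairMean_apply, effectiveSize, div_div_eq_mul_div, div_one, Finset.mul_sum,
    ← Finset.sum_sub_distrib]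
  refine Finset.sum_congr rfl fun i _ => ?_
  rw [← Finset.sum_erase_add _ _ (Finset.mem_univ i), c.inner_self]
  ring

theorem IsMaxInner.energy_mono {s : ℝ} (hs : c.IsMaxInner s) {h g : ℝ → ℝ}
    (hhg : ∀ t ∈ Icc (-1) s, h t ≤ g t) : c.energy h ≤ c.energy g :=
  Finset.sum_le_sum fun i _ => Finset.sum_le_sum fun j hj =>
    mul_le_mul_of_nonneg_left (hhg _ (hs.inner_mem_Icc (Finset.ne_of_mem_erase hj).symm))
      (mul_pos (c.weight_pos i) (c.weight_pos j)).le

theorem IsDesign.pairMean_eq {τ : ℕ} (hc : c.IsDesign τ) (hn : 2 ≤ n) {f : ℝ[X]}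
    (hf : f.degree < (τ + 1 : ℕ)) : c.pairMean f = gegenbauerMean hn f := by
  refine sub_eq_zero.1 (linearMap_eq_zero_of_degree_lt (gegenbauerSequence hn)
    (c.pairMean - gegenbauerMean hn) (fun l hl => ?_) hf)
  change c.pairMean (gegenbauerPoly n l) - gegenbauerMean hn (gegenbauerPoly n l) = 0
  rcases Nat.eq_zero_or_pos l with rfl | hl0
  · rw [gegenbauerPoly_zero, gegenbauerMean_one, pairMean_apply]
    simp only [eval_one, mul_one]
    rw [← Finset.sum_mul_sum, c.sum_weight, mul_one, sub_self]
  · obtain ⟨i, rfl⟩ := Nat.exists_eq_add_of_le' hl0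
    rw [gegenbauerMean_gegenbauerPoly_succ, sub_zero, pairMean_apply]
    exact hc (i + 1) hl0 (by lia)

theorem IsDesign.nonnegBelow {d : ℕ} (hc : c.IsDesign (d + 1)) (hn : 2 ≤ n) {s : ℝ}
    (hs : c.IsMaxInner s) : NonnegBelow hn s d := by
  intro u hu hu0
  have hfactor : (C s - X) * (1 - X) * u = (X - C s) * ((X - C 1) * u) := by
    rw [C_1]
    ring
  have hdeg : ((C s - X) * (1 - X) * u).degree < ((d + 1 + 1 : ℕ) : WithBot ℕ) := by
    rwa [hfactor, show d + 1 + 1 = 1 + (1 + d) by lia,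
      degree_mul_lt_iff (d := 1) (degree_X_sub_C s), degree_mul_lt_iff (d := 1) (degree_X_sub_C 1)]
  rw [← hc.pairMean_eq hn hdeg, pairMean_apply]
  refine Finset.sum_nonneg fun i _ => Finset.sum_nonneg fun j _ => ?_
  refine mul_nonneg (mul_pos (c.weight_pos i) (c.weight_pos j)).le ?_
  rw [eval_mul, eval_mul, eval_sub, eval_sub, eval_C, eval_X, eval_one]
  rcases eq_or_ne i j with rfl | hij
  · rw [c.inner_self, sub_self, mul_zero, zero_mul]
  · have hlt := c.inner_lt_one hij
    exact mul_nonneg (mul_nonneg (sub_nonneg.2 (hs.inner_mem_Icc hij).2) (sub_nonneg.2 hlt.le))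
      (hu0 _ ⟨c.neg_one_le_inner i j, hlt.le⟩)

theorem IsDesign.levenshteinAdmissible {k ε : ℕ} (hc : c.IsDesign (2 * k + 1 + ε)) (hn : 2 ≤ n)
    (hε : ε ≤ 1) {s : ℝ} (hs : c.IsMaxInner s)
    (hlow : dgsBound n (2 * k + 1 + ε) < levenshteinBound n (k + 1) ε s) :
    LevenshteinAdmissible hn k ε s where
  le_one := hε
  lt_one := hs.mem_Ico.2
  nonnegBelow := IsDesign.nonnegBelow (Nat.add_right_comm _ ε 1 ▸ hc) hn hs
  dgsBound_lt := hlow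

theorem IsDesign.energy_le {τ : ℕ} (hc : c.IsDesign τ) (hn : 2 ≤ n) {s : ℝ}
    (hs : c.IsMaxInner s) {g : ℝ[X]} (hg : g.degree < (τ + 1 : ℕ)) {h : ℝ → ℝ}
    (hle : ∀ t ∈ Icc (-1) s, h t ≤ g.eval t) :
    c.energy h ≤ gegenbauerCoeffZero n g - g.eval 1 / c.effectiveSize := by
  rw [← gegenbauerMean_apply hn, ← hc.pairMean_eq hn hg, ← energy_eval]
  exact hs.energy_mono hle

end WeightedCode

section Majorant

variable {n : ℕ} {hn : 2 ≤ n} {k ε : ℕ} {s : ℝ}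

namespace LevenshteinAdmissible

include hn in
theorem eval_prod_interpolationNodes_nonpos {x : ℝ} (hx : x ∈ Icc (-1) s) :
    ((interpolationNodes n (k + 1) ε s).map fun t => X - C t).prod.eval x ≤ 0 := by
  have h₁ : x - s ≤ 0 := sub_nonpos.2 hx.2
  have h₂ : 0 ≤ x + 1 := by linarith [hx.1]
  rw [interpolationNodes_eq hn, roots_levenshteinNodal hn]
  simp only [Multiset.map_add, Multiset.map_cons, Multiset.map_nsmul, Multiset.map_singleton,
    Multiset.prod_add, Multiset.prod_cons, Multiset.prod_nsmul, Multiset.prod_singleton, eval_mul,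
    eval_pow, eval_sub, eval_X, eval_C, sub_neg_eq_add]
  rw [mul_assoc, mul_assoc]
  exact mul_nonpos_of_nonpos_of_nonneg h₁ (mul_nonneg (pow_nonneg h₂ ε) (mul_self_nonneg _))

variable (h : LevenshteinAdmissible hn k ε s)

include h

theorem interpolationNodes_eq_val_add_val : interpolationNodes n (k + 1) ε s =
    (levenshteinNodes n (k + 1) ε s).val +
      (levenshteinKernel n (k + 1) ε s).roots.toFinset.val := by
  rw [interpolationNodes_eq hn, h.levenshteinNodes_val, Multiset.toFinset_val,
    h.nodup_roots_levenshteinKernel.dedup]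

theorem le_eval_of_isHermiteInterpolant (hs : -1 ≤ s) {f : ℝ → ℝ}
    (hcont : ContinuousOn f (Ico (-1) 1))
    (hdiff : ∀ j < 2 * k + 1 + ε, DifferentiableOn ℝ (iteratedDeriv j f) (Ioo (-1) 1))
    (hnonneg : ∀ t ∈ Ioo (-1 : ℝ) 1, 0 ≤ iteratedDeriv (2 * k + 1 + ε) f t) {g : ℝ[X]}
    (hg : IsHermiteInterpolant f (interpolationNodes n (k + 1) ε s) g) {x : ℝ}
    (hx : x ∈ Icc (-1) s) : f x ≤ g.eval x := by
  have hω := eval_prod_interpolationNodes_nonpos (hn := hn) (k := k) (ε := ε) hx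
  have hcard := h.card_interpolationNodes
  rw [h.interpolationNodes_eq_val_add_val] at hg hω hcard
  rw [Nat.add_right_comm] at hcard hdiff hnonneg
  refine hg.le_eval hcont (by rwa [Multiset.card_add] at hcard) hdiff hnonneg (fun α hα => ?_)
    (fun α hα => ?_) (fun α hα => ?_) ⟨hx.1, hx.2.trans_lt h.lt_one⟩ hω
  · rw [h.mem_levenshteinNodes, roots_levenshteinNodal hn]
    exact Multiset.mem_cons_of_mem (Multiset.mem_add.2 (Or.inr (Multiset.mem_toFinset.1 hα)))
  · have := h.mem_Icc_of_mem_levenshteinNodes hs hα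
    exact ⟨this.1, this.2.trans_lt h.lt_one⟩
  · have := h.mem_Ioo_of_mem_roots_levenshteinKernel (Multiset.mem_toFinset.1 hα)
    exact ⟨this.1, this.2.trans h.lt_one⟩

end LevenshteinAdmissible

end Majorant

theorem theorem5p6_general {n N k ε τ : ℕ} (hn : 2 ≤ n) (hk : 1 ≤ k) (hε : ε ≤ 1)
    (hτ : τ = 2 * k - 1 + ε)
    (h : ℝ → ℝ) (hcont : ContinuousOn h (Set.Ico (-1) 1))
    (hdiff : ∀ j < τ, DifferentiableOn ℝ (iteratedDeriv j h) (Set.Ioo (-1) 1))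
    (hnonneg : ∀ t ∈ Set.Ioo (-1 : ℝ) 1, 0 ≤ iteratedDeriv τ h t)
    (c : WeightedCode n N) (hdes : c.IsDesign τ)
    (s : ℝ) (hs : c.IsMaxInner s)
    (N₁ : ℝ) (hN₁ : N₁ = levenshteinBound n k ε s)
    (hlow : (dgsBound n τ : ℝ) < N₁) :
    (levenshteinNodes n k ε s).card = k + ε ∧
    (∀ α ∈ levenshteinNodes n k ε s, -1 ≤ α ∧ α ≤ s) ∧
    Multiset.card (interpolationNodes n k ε s) = τ ∧
    ∃ gT : ℝ[X],
      (IsHermiteInterpolant h (interpolationNodes n k ε s) gT ∧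
        ∀ g : ℝ[X], IsHermiteInterpolant h (interpolationNodes n k ε s) g → g = gT) ∧
      c.energy h ≤
        (c.effectiveSize - N₁) * gT.eval 1 / (c.effectiveSize * N₁) +
          ∑ α ∈ levenshteinNodes n k ε s, levenshteinWeight n k ε s α * h α := by
  obtain ⟨k, rfl⟩ := Nat.exists_eq_add_of_le' hk
  obtain rfl : τ = 2 * k + 1 + ε := by lia
  have hN₁pos : 0 < N₁ := (Nat.cast_nonneg _).trans_lt hlow
  have hadm := hdes.levenshteinAdmissible hn hε hs (hN₁ ▸ hlow)
  obtain ⟨g, hg⟩ := exists_isHermiteInterpolant h (interpolationNodes n (k + 1) ε s)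
  have hdeg := hadm.card_interpolationNodes ▸ hg.1
  refine ⟨hadm.card_levenshteinNodes, fun α => hadm.mem_Icc_of_mem_levenshteinNodes hs.mem_Ico.1,
    hadm.card_interpolationNodes, g, ⟨hg, fun g' hg' => hg'.unique hg⟩, ?_⟩
  have hinterp : ∑ α ∈ levenshteinNodes n (k + 1) ε s, levenshteinWeight n (k + 1) ε s α * h α =
      ∑ α ∈ levenshteinNodes n (k + 1) ε s, levenshteinWeight n (k + 1) ε s α * g.eval α :=
    Finset.sum_congr rfl fun α hα => by rw [hg.eval_eq (Multiset.mem_toFinset.1 hα)]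
  have hNW := c.effectiveSize_pos
  calc c.energy h ≤ gegenbauerCoeffZero n g - g.eval 1 / c.effectiveSize :=
        hdes.energy_le hn hs (hdeg.trans (by exact_mod_cast Nat.lt_succ_self _)) fun _ =>
          hadm.le_eval_of_isHermiteInterpolant hs.mem_Ico.1 hcont hdiff hnonneg hg
    _ = _ := by
        rw [hadm.gegenbauerCoeffZero_eq hdeg, ← hN₁, hinterp]
        field_simp
        ring

theorem theorem5p6 {n N k ε τ : ℕ} (hn : 2 ≤ n) (hk : 1 ≤ k) (hε : ε ≤ 1)
    (hτ : τ = 2 * k - 1 + ε)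
    (h : ℝ → ℝ) (hcont : ContinuousOn h (Set.Ico (-1) 1))
    (hdiff : ∀ j < τ, DifferentiableOn ℝ (iteratedDeriv j h) (Set.Ioo (-1) 1))
    (hnonneg : ∀ t ∈ Set.Ioo (-1 : ℝ) 1, 0 ≤ iteratedDeriv τ h t)
    (c : WeightedCode n N) (hdes : c.IsDesign τ)
    (s : ℝ) (hs : c.IsMaxInner s)
    (N₁ : ℝ) (hN₁ : N₁ = levenshteinBound n k ε s)
    (hlow : (dgsBound n τ : ℝ) < N₁) (hupp : N₁ ≤ (dgsBound n (τ + 1) : ℝ)) :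
    -- the nodes are `k + ε` distinct points of `[-1, s]`, and `τ` points with multiplicity
    (levenshteinNodes n k ε s).card = k + ε ∧
    (∀ α ∈ levenshteinNodes n k ε s, -1 ≤ α ∧ α ≤ s) ∧
    Multiset.card (interpolationNodes n k ε s) = τ ∧
    -- the Hermite interpolant `gT` exists and is unique, and it gives the bound
    ∃ gT : ℝ[X],
      (IsHermiteInterpolant h (interpolationNodes n k ε s) gT ∧
        ∀ g : ℝ[X], IsHermiteInterpolant h (interpolationNodes n k ε s) g → g = gT) ∧
      c.energy h ≤
        (c.effectiveSize - N₁) * gT.eval 1 / (c.effectiveSize * N₁) +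
          ∑ α ∈ levenshteinNodes n k ε s, levenshteinWeight n k ε s α * h α :=
  theorem5p6_general hn hk hε hτ h hcont hdiff hnonneg c hdes s hs N₁ hN₁ hlow
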